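/- **Lemma (Bounds on the solutions of the discrete local problems when $|\varepsilon|\ge 0$).** *Setting.* Let $d\in\{2,3\}$. Let $\Omega_-\subset\mathbb R^d$ be a (possibly empty) bounded Lipschitz polygon/polyhedron with $\mathbb R^d\setminus\overline{\Omega_-}$ connected, let $\Omega'$ be a bounded connected Lipschitz polygon/polyhedron with $\overline{\Omega_-}\subset\Omega'$, and put $\Omega=\Omega'\setminus\overline{\Omega_-}$, $\Gamma_D=\partial\Omega_-$. Let $\mathcal T^h$ be a conforming simplicial mesh of $\Omega$, and let $\mathcal V^h$ be the space of complex-valued continuous functions on $\overline\Omega$ that are polynomials of total degree at most $p$ on each element of $\mathcal T^h$ and vanish on $\Gamma_D$. Let $\Omega_1,\dots,\Omega_N\subset\Omega$ be non-empty Lipschitz polygonal/polyhedral subdomains whose closures are unions of elements of $\mathcal T^h$ and cover $\overline\Omega$, such that $\partial\Omega_\ell\cap\Gamma_D$ is empty or of positive surface measure; let $H_\ell>0$ be the characteristic length scale of $\Omega_\ell$, and $H=\max_\ell H_\ell$. Fix $\ell$, and let $\Gamma_{I,\ell}=\partial\Omega_\ell\setminus\Gamma_D$, $H^1_{0,\Gamma_D}(\Omega_\ell)=\{v\in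 H^1(\Omega_\ell): v=0\text{ on }\partial\Omega_\ell\cap\Gamma_D\}$ and $\mathcal V^h_\ell=\{v_h|_{\Omega_\ell}: v_h\in\mathcal V^h\}$. Let $A$ be a measurable field of real symmetric $d\times d$ matrices and $n$ a measurable real function with $A_{\min,\ell}\le A\le A_{\max,\ell}$ (as quadratic forms) a.e. in $\Omega_\ell$ and $n_{\min,\ell}\le n\le n_{\max,\ell}$ a.e. in $\Omega_\ell$ and a.e. on $\Gamma_{I,\ell}$, where $A_{\min,\ell},n_{\min,\ell}>0$. Let $k>0$ and $|\varepsilon|\le k^2$, let $\operatorname{sign}(\varepsilon)=1$ for $\varepsilon\ge0$ and $-1$ for $\varepsilon<0$, and let either $\eta=\operatorname{sign}(\varepsilon)k$ or $\eta=\sqrt{k^2+\mathrm i\varepsilon}$ (branch cut on the positive real axis, $\eta=k$ if $\varepsilon=0$). For $u,v\in H^1(\Omega_\ell)$ put $$a_{\varepsilon,\ell}(u,v)=\int_{\Omega_\ell}A\nabla u\cdot\overline{\nabla v}-(k^2+\mathrm i\varepsilon)\int_{\Omega_\ell}n\,u\,\bar v-\mathrm i\eta\int_{\Gamma_{I,\ell}}\sqrt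 n\,u\,\bar v\,ds,\qquad \|v\|_{1,k,\Omega_\ell}^2=\|\nabla v\|^2_{L^2(\Omega_\ell)}+k^2\|v\|^2_{L^2(\Omega_\ell)}.$$ *Constants.* Let $C_{\rm tr}$ be any constant such that $\|v\|^2_{L^2(\partial\Omega_\ell)}\le C_{\rm tr}\|v\|_{L^2(\Omega_\ell)}\big(H_\ell^{-1}\|v\|_{L^2(\Omega_\ell)}+\|\nabla v\|_{L^2(\Omega_\ell)}\big)$ for all $v\in H^1(\Omega_\ell)$, and $$C_{\mathrm{cont},\ell}=\max\{A_{\max,\ell},\sqrt2\,n_{\max,\ell}\}+\sqrt{n_{\max,\ell}}\,C_{\rm tr}\frac{|\eta|}{k}\Big(\frac12+\frac1{kH_\ell}\Big).$$ Let $C_{\mathrm{sol},\ell}$ be any bound on the local solution operator, that is, any constant such that $\|u\|_{1,k,\Omega_\ell}\le C_{\mathrm{sol},\ell}\,H\,\|f\|_{L^2(\Omega_\ell)}$ whenever $f\in L^2(\Omega_\ell)$ and $u\in H^1_{0,\Gamma_D}(\Omega_\ell)$ satisfy $a_{\varepsilon,\ell}(u,v)=(f,v)_{L^2(\Omega_\ell)}$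 for all $v\in H^1_{0,\Gamma_D}(\Omega_\ell)$. (Such a constant exists if $\varepsilon\ne0$, or $d=2$, or $A$ is piecewise Lipschitz.) For $f\in L^2(\Omega_\ell)$ let $\mathcal S^*_{\varepsilon,\ell}f\in H^1_{0,\Gamma_D}(\Omega_\ell)$ be the solution of $a_{\varepsilon,\ell}(v,\mathcal S^*_{\varepsilon,\ell}f)=(v,f)_{L^2(\Omega_\ell)}$ for all $v\in H^1_{0,\Gamma_D}(\Omega_\ell)$, and let $$\eta(\mathcal V^h_\ell)=\sup_{0\ne f\in L^2(\Omega_\ell)}\ \min_{v_h\in\mathcal V^h_\ell}\frac{\|\mathcal S^*_{\varepsilon,\ell}f-v_h\|_{1,k,\Omega_\ell}}{\|f\|_{L^2(\Omega_\ell)}}.$$ *Claim.* Suppose that $$\frac{|\varepsilon-\operatorname{sign}(\varepsilon)k^2|}{k}\,\eta(\mathcal V^h_\ell)\le\frac{\min\{A_{\min,\ell},n_{\min,\ell}\}}{8\,C_{\mathrm{cont},\ell}\,n_{\max,\ell}}.$$ Then for every (continuous) antilinear functional $F$ on $\mathcal V^h_\ell$ there is a unique $u_{h,\ell}\in\mathcal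 V^h_\ell$ with $a_{\varepsilon,\ell}(u_{h,\ell},v_{h})=F(v_{h})$ for all $v_{h}\in\mathcal V^h_\ell$, and $$\|u_{h,\ell}\|_{1,k,\Omega_\ell}\le\frac{9+8\,C_{\mathrm{sol},\ell}\,H\,n_{\max,\ell}\,|\varepsilon-\operatorname{sign}(\varepsilon)k^2|\,k^{-1}}{\min\{A_{\min,\ell},n_{\min,\ell}\}}\ \sup_{0\ne v_h\in\mathcal V^h_\ell}\frac{|F(v_h)|}{\|v_h\|_{1,k,\Omega_\ell}}.$$ -/

import Mathlib

open MeasureTheory Filter Topology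
open scoped ENNReal NNReal ContDiff ComplexConjugate

noncomputable section

namespace LocalHelmholtz

/-! ### Geometry -/

/-- The Euclidean space `ℝ^d`. -/
abbrev Space (d : ℕ) := EuclideanSpace ℝ (Fin d)

/-- The surface measure: the `(d-1)`-dimensional Hausdorff measure on `ℝ^d`, normalised so that it
is the Lebesgue measure on hyperplanes. -/
def surface (d : ℕ) : Measure (Space d) := Measure.euclideanHausdorffMeasure (d - 1)

/-- Bounded (open) Lipschitz set: near each boundary point, in a suitable orthonormal coordinate
system with last axis `e`, the set is the region strictly above the graph of a Lipschitz function
of the remaining coordinates `y - ⟪e, y⟫ e`. -/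
structure IsBoundedLipschitz {d : ℕ} (D : Set (Space d)) : Prop where
  isOpen : IsOpen D
  isBounded : Bornology.IsBounded D
  locally_graph : ∀ x ∈ frontier D, ∃ e : Space d, ‖e‖ = 1 ∧ ∃ (C : ℝ≥0) (γ : Space d → ℝ),
    LipschitzWith C γ ∧ ∃ U : Set (Space d), IsOpen U ∧ x ∈ U ∧
      ∀ y ∈ U, (y ∈ D ↔ γ (y - inner ℝ e y • e) < inner ℝ e y)

/-- Bounded Lipschitz polygon (`d = 2`) or polyhedron (`d = 3`): a bounded Lipschitz open set whose
boundary lies in a finite union of hyperplanes `{y | ⟪ν, y⟫ = c}`. -/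
structure IsLipschitzPolytope {d : ℕ} (D : Set (Space d)) : Prop extends
    IsBoundedLipschitz D where
  flat_boundary : ∃ P : Finset (Space d × ℝ), (∀ q ∈ P, q.1 ≠ 0) ∧
    frontier D ⊆ ⋃ q ∈ P, {y | inner ℝ q.1 y = q.2}

/-- The obstacle `Ωm` (possibly empty) and the outer domain `Ωout`. The computational domain is
`Ωout \ closure Ωm`, and the Dirichlet boundary is `frontier Ωm`. -/
structure IsObstacleInDomain {d : ℕ} (Ωm Ωout : Set (Space d)) : Prop where
  obstacle : IsLipschitzPolytope Ωm
  exterior_connected : IsConnected (closure Ωm)ᶜ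
  outer : IsLipschitzPolytope Ωout
  outer_connected : IsConnected Ωout
  closure_subset : closure Ωm ⊆ Ωout

/-- The elements (top-dimensional simplices, given by their vertices) of a simplicial complex. -/
def elements {d : ℕ} (K : Geometry.SimplicialComplex ℝ (Space d)) : Set (Finset (Space d)) :=
  {s ∈ K.faces | s.card = d + 1}

/-- `K` is a (conforming, simplicial) mesh of `Ω`. -/
structure IsMesh {d : ℕ} (K : Geometry.SimplicialComplex ℝ (Space d)) (Ω : Set (Space d)) :
    Prop where
  finite : K.faces.Finite
  pure : ∀ s ∈ K.faces, ∃ t ∈ elements K, s ⊆ t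
  space_eq : K.space = closure Ω

/-- `Ωs 0, …, Ωs (N-1)` is a cover of `Ω` by Lipschitz polyhedral subdomains that are
unions of elements of the mesh `K`, with positive characteristic length scales `Hs`. -/
structure IsDecomposition {d N : ℕ} (K : Geometry.SimplicialComplex ℝ (Space d))
    (Ω ΓD : Set (Space d)) (Ωs : Fin N → Set (Space d)) (Hs : Fin N → ℝ) : Prop where
  polytope : ∀ l, IsLipschitzPolytope (Ωs l)
  nonempty : ∀ l, (Ωs l).Nonempty
  subset : ∀ l, Ωs l ⊆ Ω
  cover : closure Ω ⊆ ⋃ l, closure (Ωs l)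
  union_of_elements : ∀ l, ∃ T ⊆ elements K,
    closure (Ωs l) = ⋃ s ∈ T, convexHull ℝ (s : Set (Space d))
  dirichlet_part : ∀ l, (frontier (Ωs l) ∩ ΓD).Nonempty →
    0 < surface d (frontier (Ωs l) ∩ ΓD)
  length_pos : ∀ l, 0 < Hs l

/-! ### Sobolev spaces -/

/-- Complex `L²(D)`. -/
abbrev L2 {d : ℕ} (D : Set (Space d)) := Lp ℂ 2 (volume.restrict D)

/-- `L²(D; ℂ^d)`. -/
abbrev L2Vec {d : ℕ} (D : Set (Space d)) := Lp (EuclideanSpace ℂ (Fin d)) 2 (volume.restrict D)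

/-- Complex `L²(∂D)` with respect to the surface measure. -/
abbrev L2Bdry {d : ℕ} (D : Set (Space d)) := Lp ℂ 2 ((surface d).restrict (frontier D))

/-- Triples (function, gradient, boundary values). A Sobolev function `u` on a Lipschitz domain is
represented by the triple `(u, ∇u, trace of u)`, which is determined by `u`. -/
abbrev Triple {d : ℕ} (D : Set (Space d)) := L2 D × L2Vec D × L2Bdry D

variable {d : ℕ} {D : Set (Space d)}

/-- The function of a triple. -/
abbrev fn (w : Triple D) : L2 D := w.1

/-- The gradient of a triple. -/
abbrev grad (w : Triple D) : L2Vec D := w.2.1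

/-- The boundary trace of a triple. -/
abbrev trace (w : Triple D) : L2Bdry D := w.2.2

/-- The classical gradient of a complex-valued function on `ℝ^d`. -/
def classicalGrad (φ : Space d → ℂ) (x : Space d) : EuclideanSpace ℂ (Fin d) :=
  WithLp.toLp 2 fun i => fderiv ℝ φ x (EuclideanSpace.single i 1)

/-- `G` is the weak gradient of `u` on the open set `D`. -/
def IsWeakGrad (u : L2 D) (G : L2Vec D) : Prop :=
  ∀ φ : Space d → ℝ, ContDiff ℝ ∞ φ → HasCompactSupport φ → tsupport φ ⊆ D → ∀ i : Fin d,
    ∫ x in D, u x * (fderiv ℝ φ x (EuclideanSpace.single i 1) : ℝ) =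
      -∫ x in D, G x i * (φ x : ℂ)

/-- `g` is the trace on `∂D` of the Sobolev function `u` with gradient `G`: there are smooth
functions `φ m` on `ℝ^d` with `φ m → u` in `H¹(D)` and `φ m → g` in `L²(∂D)`. -/
def IsTrace (u : L2 D) (G : L2Vec D) (g : L2Bdry D) : Prop :=
  ∃ φ : ℕ → Space d → ℂ, (∀ m, ContDiff ℝ ∞ (φ m)) ∧
    Tendsto (fun m => eLpNorm (fun x => φ m x - u x) 2 (volume.restrict D)) atTop (𝓝 0) ∧
    Tendsto (fun m => eLpNorm (fun x => classicalGrad (φ m) x - G x) 2 (volume.restrict D))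
      atTop (𝓝 0) ∧
    Tendsto (fun m => eLpNorm (fun x => φ m x - g x) 2 ((surface d).restrict (frontier D)))
      atTop (𝓝 0)

theorem integrable_mul_test {μ : Measure (Space d)} [IsFiniteMeasureOnCompacts μ]
    {f : Space d → ℂ} (hf : MemLp f 2 μ) {ψ : Space d → ℝ} (hψ : Continuous ψ)
    (hc : HasCompactSupport ψ) : Integrable (fun x => f x * (ψ x : ℂ)) μ := by
  have h1 : Continuous fun x => (ψ x : ℂ) := Complex.continuous_ofReal.comp hψ
  have h2 : HasCompactSupport fun x => (ψ x : ℂ) :=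
    hc.comp_left (g := fun t : ℝ => (t : ℂ)) Complex.ofReal_zero
  exact MemLp.integrable_mul (p := 2) (q := 2) hf (h1.memLp_of_hasCompactSupport h2)

theorem continuous_partial {φ : Space d → ℝ} (hφ : ContDiff ℝ ∞ φ) (e : Space d) :
    Continuous fun x => fderiv ℝ φ x e :=
  (hφ.continuous_fderiv (by simp)).clm_apply continuous_const

theorem IsWeakGrad.zero : IsWeakGrad (0 : L2 D) (0 : L2Vec D) := by
  intro φ _ _ _ i
  have h1 : ∫ x in D, (0 : L2 D) x * (fderiv ℝ φ x (EuclideanSpace.single i 1) : ℝ) = 0 := by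
    refine integral_eq_zero_of_ae ?_
    filter_upwards [Lp.coeFn_zero ℂ 2 (volume.restrict D)] with x hx
    simp only [hx, Pi.zero_apply, zero_mul]
  have h2 : ∫ x in D, (0 : L2Vec D) x i * (φ x : ℂ) = 0 := by
    refine integral_eq_zero_of_ae ?_
    filter_upwards [Lp.coeFn_zero (EuclideanSpace ℂ (Fin d)) 2 (volume.restrict D)] with x hx
    simp only [hx, Pi.zero_apply, PiLp.zero_apply, zero_mul]
  rw [h1, h2, neg_zero]

theorem memLp_component (G : L2Vec D) (i : Fin d) :
    MemLp (fun x => G x i) 2 (volume.restrict D) :=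
  (EuclideanSpace.proj (𝕜 := ℂ) i).comp_memLp' (Lp.memLp G)

theorem IsWeakGrad.add {u v : L2 D} {G H : L2Vec D} (hu : IsWeakGrad u G)
    (hv : IsWeakGrad v H) : IsWeakGrad (u + v) (G + H) := by
  intro φ h1 h2 h3 i
  have hc := h2.fderiv_apply ℝ (EuclideanSpace.single i (1 : ℝ))
  have hd := continuous_partial h1 (EuclideanSpace.single i (1 : ℝ))
  have e1 : ∫ x in D, (u + v) x * (fderiv ℝ φ x (EuclideanSpace.single i 1) : ℝ) =
      ∫ x in D, (u x * (fderiv ℝ φ x (EuclideanSpace.single i 1) : ℝ) +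
        v x * (fderiv ℝ φ x (EuclideanSpace.single i 1) : ℝ)) := by
    refine integral_congr_ae ?_
    filter_upwards [Lp.coeFn_add u v] with x hx
    simp only [hx, Pi.add_apply, add_mul]
  have e2 : ∫ x in D, (G + H) x i * (φ x : ℂ) =
      ∫ x in D, (G x i * (φ x : ℂ) + H x i * (φ x : ℂ)) := by
    refine integral_congr_ae ?_
    filter_upwards [Lp.coeFn_add G H] with x hx
    simp only [hx, Pi.add_apply, PiLp.add_apply, add_mul]
  rw [e1, e2, integral_add (integrable_mul_test (Lp.memLp u) hd hc)
    (integrable_mul_test (Lp.memLp v) hd hc),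
    integral_add (integrable_mul_test (memLp_component G i) h1.continuous h2)
    (integrable_mul_test (memLp_component H i) h1.continuous h2),
    hu φ h1 h2 h3 i, hv φ h1 h2 h3 i, neg_add]

theorem IsWeakGrad.smul {u : L2 D} {G : L2Vec D} (c : ℂ) (hu : IsWeakGrad u G) :
    IsWeakGrad (c • u) (c • G) := by
  intro φ h1 h2 h3 i
  have e1 : ∫ x in D, (c • u) x * (fderiv ℝ φ x (EuclideanSpace.single i 1) : ℝ) =
      ∫ x in D, c * (u x * (fderiv ℝ φ x (EuclideanSpace.single i 1) : ℝ)) := by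
    refine integral_congr_ae ?_
    filter_upwards [Lp.coeFn_smul c u] with x hx
    simp only [hx, Pi.smul_apply, smul_eq_mul, mul_assoc]
  have e2 : ∫ x in D, (c • G) x i * (φ x : ℂ) = ∫ x in D, c * (G x i * (φ x : ℂ)) := by
    refine integral_congr_ae ?_
    filter_upwards [Lp.coeFn_smul c G] with x hx
    simp only [hx, Pi.smul_apply, PiLp.smul_apply, smul_eq_mul, mul_assoc]
  rw [e1, e2, integral_const_mul, integral_const_mul, hu φ h1 h2 h3 i, mul_neg]

theorem continuous_classicalGrad {φ : Space d → ℂ} (hφ : ContDiff ℝ ∞ φ) :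
    Continuous (classicalGrad φ) :=
  (PiLp.continuous_toLp 2 _).comp <| continuous_pi fun _ =>
    (hφ.continuous_fderiv (by simp)).clm_apply continuous_const

theorem classicalGrad_add {φ ψ : Space d → ℂ} (hφ : ContDiff ℝ ∞ φ) (hψ : ContDiff ℝ ∞ ψ)
    (x : Space d) : classicalGrad (φ + ψ) x = classicalGrad φ x + classicalGrad ψ x := by
  ext i
  simp [classicalGrad, fderiv_add (hφ.differentiable (by simp) x) (hψ.differentiable (by simp) x)]

theorem classicalGrad_smul {φ : Space d → ℂ} (hφ : ContDiff ℝ ∞ φ) (c : ℂ) (x : Space d) :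
    classicalGrad (c • φ) x = c • classicalGrad φ x := by
  ext i
  simp [classicalGrad, fderiv_const_smul (hφ.differentiable (by simp) x) c]

theorem tendsto_eLpNorm_add {F : Type*} [NormedAddCommGroup F] {μ : Measure (Space d)}
    (u v : Lp F 2 μ) {f g : ℕ → Space d → F}
    (hf : ∀ m, AEStronglyMeasurable (f m) μ) (hg : ∀ m, AEStronglyMeasurable (g m) μ)
    (h1 : Tendsto (fun m => eLpNorm (fun x => f m x - u x) 2 μ) atTop (𝓝 0))
    (h2 : Tendsto (fun m => eLpNorm (fun x => g m x - v x) 2 μ) atTop (𝓝 0)) :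
    Tendsto (fun m => eLpNorm (fun x => (f m x + g m x) - (u + v) x) 2 μ) atTop (𝓝 0) := by
  refine tendsto_of_tendsto_of_tendsto_of_le_of_le tendsto_const_nhds
    (by simpa using h1.add h2) (fun _ => zero_le) fun m => ?_
  have : eLpNorm (fun x => (f m x + g m x) - (u + v) x) 2 μ =
      eLpNorm ((fun x => f m x - u x) + fun x => g m x - v x) 2 μ := by
    refine eLpNorm_congr_ae ?_
    filter_upwards [Lp.coeFn_add u v] with x hx
    simp only [hx, Pi.add_apply]
    abel
  rw [this]
  exact eLpNorm_add_le ((hf m).sub (Lp.aestronglyMeasurable u))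
    ((hg m).sub (Lp.aestronglyMeasurable v)) (by norm_num)

theorem tendsto_eLpNorm_smul {F : Type*} [NormedAddCommGroup F] [NormedSpace ℂ F]
    {μ : Measure (Space d)} (u : Lp F 2 μ) (c : ℂ) {f : ℕ → Space d → F}
    (h1 : Tendsto (fun m => eLpNorm (fun x => f m x - u x) 2 μ) atTop (𝓝 0)) :
    Tendsto (fun m => eLpNorm (fun x => c • f m x - (c • u) x) 2 μ) atTop (𝓝 0) := by
  have h2 : Tendsto (fun m => ‖c‖ₑ * eLpNorm (fun x => f m x - u x) 2 μ) atTop (𝓝 0) := by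
    simpa using ENNReal.Tendsto.const_mul h1 (Or.inr enorm_ne_top)
  refine h2.congr fun m => ?_
  rw [← eLpNorm_const_smul]
  refine eLpNorm_congr_ae ?_
  filter_upwards [Lp.coeFn_smul c u] with x hx
  simp only [hx, Pi.smul_apply, smul_sub]

theorem IsTrace.zero : IsTrace (0 : L2 D) (0 : L2Vec D) (0 : L2Bdry D) := by
  have key : ∀ {F : Type} [NormedAddCommGroup F] (μ : Measure (Space d)),
      eLpNorm (fun x => (0 : F) - (0 : Lp F 2 μ) x) 2 μ = 0 := by
    intro F _ μ
    rw [← eLpNorm_zero (ε := F) (α := Space d) (p := 2) (μ := μ)]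
    refine eLpNorm_congr_ae ?_
    filter_upwards [Lp.coeFn_zero F 2 μ] with x hx
    simp only [hx, Pi.zero_apply, sub_zero]
  refine ⟨fun _ _ => 0, fun _ => contDiff_const, ?_, ?_, ?_⟩
  · simp only [key]; exact tendsto_const_nhds
  · have : ∀ x : Space d, classicalGrad (fun _ : Space d => (0 : ℂ)) x = 0 := by
      intro x; ext i; simp [classicalGrad]
    simp only [this, key]; exact tendsto_const_nhds
  · simp only [key]; exact tendsto_const_nhds

theorem IsTrace.add {u v : L2 D} {G H : L2Vec D} {g h : L2Bdry D} (hu : IsTrace u G g)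
    (hv : IsTrace v H h) : IsTrace (u + v) (G + H) (g + h) := by
  obtain ⟨φ, a0, a1, a2, a3⟩ := hu
  obtain ⟨ψ, b0, b1, b2, b3⟩ := hv
  refine ⟨fun m => φ m + ψ m, fun m => (a0 m).add (b0 m), ?_, ?_, ?_⟩
  · exact tendsto_eLpNorm_add u v (fun m => (a0 m).continuous.aestronglyMeasurable)
      (fun m => (b0 m).continuous.aestronglyMeasurable) a1 b1
  · simp only [classicalGrad_add (a0 _) (b0 _)]
    exact tendsto_eLpNorm_add G H
      (fun m => (continuous_classicalGrad (a0 m)).aestronglyMeasurable)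
      (fun m => (continuous_classicalGrad (b0 m)).aestronglyMeasurable) a2 b2
  · exact tendsto_eLpNorm_add g h (fun m => (a0 m).continuous.aestronglyMeasurable)
      (fun m => (b0 m).continuous.aestronglyMeasurable) a3 b3

theorem IsTrace.smul {u : L2 D} {G : L2Vec D} {g : L2Bdry D} (c : ℂ) (hu : IsTrace u G g) :
    IsTrace (c • u) (c • G) (c • g) := by
  obtain ⟨φ, a0, a1, a2, a3⟩ := hu
  refine ⟨fun m => c • φ m, fun m => (a0 m).const_smul c, ?_, ?_, ?_⟩
  · exact tendsto_eLpNorm_smul u c a1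
  · simp only [classicalGrad_smul (a0 _) c]
    exact tendsto_eLpNorm_smul G c a2
  · exact tendsto_eLpNorm_smul g c a3

variable (D) in
/-- The Sobolev space `H¹(D)` of a bounded Lipschitz domain `D`: square-integrable functions with
square-integrable weak gradient (and their traces in `L²(∂D)`). -/
def H1 : Submodule ℂ (Triple D) where
  carrier := {w | IsWeakGrad (fn w) (grad w) ∧ IsTrace (fn w) (grad w) (trace w)}
  zero_mem' := ⟨IsWeakGrad.zero, IsTrace.zero⟩
  add_mem' := fun h h' => ⟨h.1.add h'.1, h.2.add h'.2⟩
  smul_mem' := fun c _ h => ⟨h.1.smul c, h.2.smul c⟩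

variable (D) in
/-- `H¹_{0,ΓD}(D)`: the functions of `H¹(D)` that vanish on `∂D ∩ ΓD`. -/
def H10 (ΓD : Set (Space d)) : Submodule ℂ (Triple D) where
  carrier := {w | w ∈ H1 D ∧ ∀ᵐ x ∂((surface d).restrict (frontier D)), x ∈ ΓD → trace w x = 0}
  zero_mem' := by
    refine ⟨(H1 D).zero_mem, ?_⟩
    filter_upwards [Lp.coeFn_zero ℂ 2 ((surface d).restrict (frontier D))] with x hx _
    exact hx
  add_mem' := by
    rintro v w ⟨hv, hv'⟩ ⟨hw, hw'⟩
    refine ⟨(H1 D).add_mem hv hw, ?_⟩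
    filter_upwards [hv', hw', Lp.coeFn_add (trace v) (trace w)] with x h1 h2 h3 hx
    exact h3.trans (by simp only [Pi.add_apply, h1 hx, h2 hx, add_zero])
  smul_mem' := by
    rintro c w ⟨hw, hw'⟩
    refine ⟨(H1 D).smul_mem c hw, ?_⟩
    filter_upwards [hw', Lp.coeFn_smul c (trace w)] with x h1 h2 hx
    exact h2.trans (by simp only [Pi.smul_apply, h1 hx, smul_zero])

/-- The energy norm `‖w‖_{1,k,D} = (‖∇w‖² + k² ‖w‖²)^{1/2}`. -/
def energyNorm (k : ℝ) (w : Triple D) : ℝ := Real.sqrt (‖grad w‖ ^ 2 + k ^ 2 * ‖fn w‖ ^ 2)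

/-! ### Finite element spaces -/

/-- The finite element space `V^h`: functions that are continuous on the closed domain covered by
the mesh `K`, coincide on each element with a polynomial of total degree at most `p`, and vanish
on `ΓD`. (Values outside the meshed domain are irrelevant.) -/
def feSpace (K : Geometry.SimplicialComplex ℝ (Space d)) (p : ℕ) (ΓD : Set (Space d)) :
    Submodule ℂ (Space d → ℂ) where
  carrier := {v | ContinuousOn v K.space ∧
    (∀ s ∈ elements K, ∃ q : MvPolynomial (Fin d) ℂ, q.totalDegree ≤ p ∧
      ∀ x ∈ convexHull ℝ (s : Set (Space d)), v x = MvPolynomial.eval (fun i => (x i : ℂ)) q) ∧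
    ∀ x ∈ ΓD, v x = 0}
  zero_mem' := ⟨continuousOn_const, fun _ _ => ⟨0, by simp, by simp⟩, by simp⟩
  add_mem' := by
    rintro v w ⟨h1, h2, h3⟩ ⟨g1, g2, g3⟩
    refine ⟨h1.add g1, fun s hs => ?_, fun x hx => by simp [h3 x hx, g3 x hx]⟩
    obtain ⟨q, hq, hv⟩ := h2 s hs
    obtain ⟨r, hr, hw⟩ := g2 s hs
    exact ⟨q + r, (MvPolynomial.totalDegree_add q r).trans (max_le hq hr),
      fun x hx => by simp [hv x hx, hw x hx]⟩
  smul_mem' := by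
    rintro c v ⟨h1, h2, h3⟩
    refine ⟨h1.const_smul c, fun s hs => ?_, fun x hx => by simp [h3 x hx]⟩
    obtain ⟨q, hq, hv⟩ := h2 s hs
    exact ⟨c • q, (MvPolynomial.totalDegree_smul_le c q).trans hq,
      fun x hx => by simp [hv x hx, MvPolynomial.smul_eval]⟩

variable (D) in
/-- The local finite element space `V^h_ℓ = {v_h|_D : v_h ∈ V^h}`, as a subspace of `H¹(D)`: the
function is `v_h` on `D`, its gradient is the weak gradient, its trace is `v_h` on `∂D`. -/
def localFE (K : Geometry.SimplicialComplex ℝ (Space d)) (p : ℕ) (ΓD : Set (Space d)) :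
    Submodule ℂ (Triple D) where
  carrier := {w | w ∈ H1 D ∧ ∃ v ∈ feSpace K p ΓD, (∀ᵐ x ∂(volume.restrict D), fn w x = v x) ∧
    ∀ᵐ x ∂((surface d).restrict (frontier D)), trace w x = v x}
  zero_mem' := ⟨(H1 D).zero_mem, 0, (feSpace K p ΓD).zero_mem, Lp.coeFn_zero _ _ _,
    Lp.coeFn_zero _ _ _⟩
  add_mem' := by
    rintro a b ⟨ha, v, hv, h1, h2⟩ ⟨hb, w, hw, g1, g2⟩
    refine ⟨(H1 D).add_mem ha hb, v + w, (feSpace K p ΓD).add_mem hv hw, ?_, ?_⟩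
    · filter_upwards [h1, g1, Lp.coeFn_add (fn a) (fn b)] with x e1 e2 e3
      exact e3.trans (by simp only [Pi.add_apply, e1, e2])
    · filter_upwards [h2, g2, Lp.coeFn_add (trace a) (trace b)] with x e1 e2 e3
      exact e3.trans (by simp only [Pi.add_apply, e1, e2])
  smul_mem' := by
    rintro c a ⟨ha, v, hv, h1, h2⟩
    refine ⟨(H1 D).smul_mem c ha, c • v, (feSpace K p ΓD).smul_mem c hv, ?_, ?_⟩
    · filter_upwards [h1, Lp.coeFn_smul c (fn a)] with x e1 e3
      exact e3.trans (by simp only [Pi.smul_apply, e1])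
    · filter_upwards [h2, Lp.coeFn_smul c (trace a)] with x e1 e3
      exact e3.trans (by simp only [Pi.smul_apply, e1])

/-! ### The local Helmholtz problem with impedance boundary condition -/

/-- `A` is a measurable field of real symmetric matrices with `Amin ≤ A ≤ Amax` (as quadratic
forms) almost everywhere in `D`, and `n` is a measurable function with `nmin ≤ n ≤ nmax` almost
everywhere in `D` and almost everywhere on the impedance boundary `∂D \ ΓD`; the lower bounds
are positive. -/
structure CoeffBounds (D ΓD : Set (Space d)) (A : Space d → Matrix (Fin d) (Fin d) ℝ)
    (n : Space d → ℝ) (Amin Amax nmin nmax : ℝ) : Prop where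
  measurable_A : ∀ i j, Measurable fun x => A x i j
  measurable_n : Measurable n
  Amin_pos : 0 < Amin
  nmin_pos : 0 < nmin
  symm_A : ∀ᵐ x ∂(volume.restrict D), (A x).IsSymm
  bounds_A : ∀ᵐ x ∂(volume.restrict D), ∀ ξ : Fin d → ℝ,
    Amin * (ξ ⬝ᵥ ξ) ≤ ξ ⬝ᵥ (A x).mulVec ξ ∧ ξ ⬝ᵥ (A x).mulVec ξ ≤ Amax * (ξ ⬝ᵥ ξ)
  bounds_n : ∀ᵐ x ∂(volume.restrict D), nmin ≤ n x ∧ n x ≤ nmax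
  bounds_n_bdry : ∀ᵐ x ∂((surface d).restrict (frontier D \ ΓD)), nmin ≤ n x ∧ n x ≤ nmax

/-- The sign of the absorption parameter, with the convention `sgn 0 = 1`. -/
def sgn (ε : ℝ) : ℝ := if 0 ≤ ε then 1 else -1

/-- The admissible impedance parameters: `η = sgn(ε) k`, or `η = √(k² + iε)` with the branch cut of
the square root on the positive real axis (so that it has nonnegative imaginary part; it is the
principal root for `ε > 0` and minus the principal root for `ε < 0`), which means `k` at `ε = 0`. -/
def IsImpedanceParameter (k ε : ℝ) (η : ℂ) : Prop :=
  η = (sgn ε * k : ℝ) ∨ η = (sgn ε : ℂ) * ((k : ℂ) ^ 2 + Complex.I * ε) ^ (1 / 2 : ℂ)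

/-- The `L²(D)` inner product `(u, v) = ∫ u v̄`. -/
def ip (u v : L2 D) : ℂ := ∫ x in D, u x * conj (v x)

/-- The local sesquilinear form
`(A ∇u, ∇v)_D - (k² + iε) (n u, v)_D - i η ⟨√n u, v⟩_{∂D \ ΓD}`. -/
def form (ΓD : Set (Space d)) (A : Space d → Matrix (Fin d) (Fin d) ℝ) (n : Space d → ℝ)
    (k ε : ℝ) (η : ℂ) (u v : Triple D) : ℂ :=
  (∫ x in D, ∑ i, ∑ j, (A x i j : ℂ) * grad u x j * conj (grad v x i)) -
    ((k : ℂ) ^ 2 + Complex.I * ε) * (∫ x in D, (n x : ℂ) * fn u x * conj (fn v x)) -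
    Complex.I * η * ∫ x in frontier D \ ΓD, (Real.sqrt (n x) : ℂ) * trace u x * conj (trace v x)
      ∂(surface d)

/-- `C` is a constant in the multiplicative trace inequality on `D`, for the length scale `L`. -/
def IsTraceConstant (D : Set (Space d)) (L C : ℝ) : Prop :=
  ∀ w ∈ H1 D, ‖trace w‖ ^ 2 ≤ C * ‖fn w‖ * (L⁻¹ * ‖fn w‖ + ‖grad w‖)

/-- `u` solves the local impedance problem with right-hand side `f ∈ L²(D)`. -/
def IsLocalSolution (ΓD : Set (Space d)) (A : Space d → Matrix (Fin d) (Fin d) ℝ)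
    (n : Space d → ℝ) (k ε : ℝ) (η : ℂ) (f : L2 D) (u : Triple D) : Prop :=
  u ∈ H10 D ΓD ∧ ∀ v ∈ H10 D ΓD, form ΓD A n k ε η u v = ip f (fn v)

/-- `C` is a bound on the local solution operator: `‖u‖_{1,k,D} ≤ C H ‖f‖` whenever `u` solves the
local problem with right-hand side `f`. -/
def IsSolutionBound (D ΓD : Set (Space d)) (A : Space d → Matrix (Fin d) (Fin d) ℝ)
    (n : Space d → ℝ) (k ε : ℝ) (η : ℂ) (H C : ℝ) : Prop :=
  ∀ (f : L2 D) (u : Triple D), IsLocalSolution ΓD A n k ε η f u →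
    energyNorm k u ≤ C * H * ‖f‖

/-- `s` solves the adjoint local problem with right-hand side `f`, that is, `s = S* f`. -/
def IsAdjointSolution (ΓD : Set (Space d)) (A : Space d → Matrix (Fin d) (Fin d) ℝ)
    (n : Space d → ℝ) (k ε : ℝ) (η : ℂ) (f : L2 D) (s : Triple D) : Prop :=
  s ∈ H10 D ΓD ∧ ∀ v ∈ H10 D ΓD, form ΓD A n k ε η v s = ip (fn v) f

/-- The adjoint approximability
`η(V) = sup_{f ≠ 0} min_{v ∈ V} ‖S* f - v‖_{1,k,D} / ‖f‖` of a subspace `V`. -/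
def adjointApprox (ΓD : Set (Space d)) (A : Space d → Matrix (Fin d) (Fin d) ℝ)
    (n : Space d → ℝ) (k ε : ℝ) (η : ℂ) (V : Submodule ℂ (Triple D)) : ℝ≥0∞ :=
  ⨆ (f : L2 D) (_ : f ≠ 0) (s : Triple D) (_ : IsAdjointSolution ΓD A n k ε η f s),
    ⨅ v ∈ V, ENNReal.ofReal (energyNorm k (s - v) / ‖f‖)

/-- The continuity constant of the local form, where `L` is the length scale of the subdomain. -/
def contConst (Amax nmax Ctr k : ℝ) (η : ℂ) (L : ℝ) : ℝ :=
  max Amax (Real.sqrt 2 * nmax) +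
    Real.sqrt nmax * Ctr * (‖η‖ / k) * (1 / 2 + 1 / (k * L))

end LocalHelmholtz

end

/-! The proof is a Schatz duality argument against the form at maximal absorption. Write
$\varepsilon_0=\operatorname{sign}(\varepsilon)k^2$, $\alpha=\min\{A_{\min},n_{\min}\}$, and let $E$
be the energy norm of $u\in V$. At $\varepsilon_0$ a combination of real and imaginary parts gives
coercivity, $\alpha E^2\le\frac94|a_{\varepsilon_0}(u,u)|$ (`energy_le_norm_form`). Passing from
$\varepsilon$ to $\varepsilon_0$ only adds a multiple of $(nu,\cdot)$. Let $s$ be the adjoint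
solution with data $f=\mathrm i(\varepsilon_0-\varepsilon)nu$. Since the factor is purely imaginary,
$a_\varepsilon(u,u+s)=a_{\varepsilon_0}(u,u)$. Replacing $s$ by a nearby $v\in V$ costs at most
$\frac\alpha4E^2$, by continuity of the form and the smallness condition. Testing with $u+v\in V$,
whose energy norm is at most $(\frac54+Q)E$ with $Q=C_{\rm
sol}Hn_{\max}|\varepsilon-\varepsilon_0|/k$, gives the stability bound
(`energyNorm_le_of_adjointApprox`). Stability makes the form nondegenerate on the finite-dimensional
$V$, hence existence and uniqueness.

Two points need separate work. The hypothesis on $C_{\rm sol}$ bounds solutions but does not supply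
them, and the supremum defining the approximability ranges only over solutions that exist. Existence
follows by continuation in the absorption (`exists_solution`): Lax–Milgram for slightly larger
absorption, then a contraction. Secondly, the adjoint problem is reduced to the direct one by
complex conjugation, as $A$ is real symmetric and $n$ is real. -/

noncomputable section

namespace LocalHelmholtz

/-! ### Bounded operators behind the sesquilinear form. -/

section

/-! ### Multiplication operators -/

section MulOp

variable {X F : Type*} [MeasurableSpace X] {μ : Measure X} [NormedAddCommGroup F]
  [InnerProductSpace ℂ F]

/-- A bounded measurable field of operators acts on `L²` by pointwise application. -/
theorem exists_mulOp (m : X → F →L[ℂ] F) (hm : AEStronglyMeasurable m μ) {C : ℝ}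
    (hC : ∀ᵐ x ∂μ, ‖m x‖ ≤ C) :
    ∃ M : Lp F 2 μ →L[ℂ] Lp F 2 μ, (∀ u, ∀ᵐ x ∂μ, M u x = m x (u x)) ∧
      ∀ u, ‖M u‖ ≤ C * ‖u‖ := by
  have hle : ∀ u : Lp F 2 μ, ∀ᵐ x ∂μ, ‖m x (u x)‖ ≤ C * ‖u x‖ := fun u => by
    filter_upwards [hC] with x hx
    exact (m x).le_of_opNorm_le hx _
  have hmem : ∀ u : Lp F 2 μ, MemLp (fun x => m x (u x)) 2 μ := fun u =>
    (Lp.memLp u).of_le_mul (isBoundedBilinearMap_apply.continuous.comp_aestronglyMeasurable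
      (hm.prodMk (Lp.aestronglyMeasurable u))) (hle u)
  have hcoe : ∀ u : Lp F 2 μ, ∀ᵐ x ∂μ, (hmem u).toLp _ x = m x (u x) := fun u =>
    (hmem u).coeFn_toLp
  have hnorm : ∀ u : Lp F 2 μ, ‖(hmem u).toLp _‖ ≤ C * ‖u‖ := fun u => by
    refine Lp.norm_le_mul_norm_of_ae_le_mul ?_
    filter_upwards [hle u, hcoe u] with x h1 h2
    rwa [h2]
  refine ⟨LinearMap.mkContinuous
    { toFun := fun u => (hmem u).toLp _
      map_add' := fun u v => ?_
      map_smul' := fun c u => ?_ } C hnorm, hcoe, hnorm⟩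
  · refine Lp.ext ?_
    filter_upwards [hcoe u, hcoe v, hcoe (u + v), Lp.coeFn_add u v,
      Lp.coeFn_add ((hmem u).toLp _) ((hmem v).toLp _)] with x h1 h2 h3 h4 h5
    rw [h3, h5, h4, Pi.add_apply, Pi.add_apply, h1, h2, map_add]
  · refine Lp.ext ?_
    filter_upwards [hcoe u, hcoe (c • u), Lp.coeFn_smul c u,
      Lp.coeFn_smul c ((hmem u).toLp _)] with x h1 h2 h3 h4
    rw [h2, RingHom.id_apply, h4, h3, Pi.smul_apply, Pi.smul_apply, h1, map_smul]

theorem inner_mulOp {m : X → F →L[ℂ] F} {M : Lp F 2 μ →L[ℂ] Lp F 2 μ}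
    (hM : ∀ u, ∀ᵐ x ∂μ, M u x = m x (u x)) (u v : Lp F 2 μ) :
    inner ℂ v (M u) = ∫ x, inner ℂ (v x) (m x (u x)) ∂μ := by
  rw [L2.inner_def]
  refine integral_congr_ae ?_
  filter_upwards [hM u] with x hx
  rw [hx]

theorem im_inner_mulOp_self {m : X → F →L[ℂ] F} {M : Lp F 2 μ →L[ℂ] Lp F 2 μ}
    (hM : ∀ u, ∀ᵐ x ∂μ, M u x = m x (u x)) (him : ∀ᵐ x ∂μ, ∀ ξ, (inner ℂ ξ (m x ξ)).im = 0)
    (u : Lp F 2 μ) : (inner ℂ u (M u)).im = 0 := by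
  rw [L2.inner_def]
  have h := integral_im (L2.integrable_inner (𝕜 := ℂ) u (M u))
  refine h.symm.trans (integral_eq_zero_of_ae ?_)
  filter_upwards [hM u, him] with x hx h
  rw [hx]
  exact h _

theorem le_re_inner_mulOp_self {m : X → F →L[ℂ] F} {M : Lp F 2 μ →L[ℂ] Lp F 2 μ}
    (hM : ∀ u, ∀ᵐ x ∂μ, M u x = m x (u x)) {c : ℝ}
    (hc : ∀ᵐ x ∂μ, ∀ ξ, c * ‖ξ‖ ^ 2 ≤ (inner ℂ ξ (m x ξ)).re) (u : Lp F 2 μ) :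
    c * ‖u‖ ^ 2 ≤ (inner ℂ u (M u)).re := by
  have h1 := integral_re (L2.integrable_inner (𝕜 := ℂ) u (M u))
  have h2 := integral_re (L2.integrable_inner (𝕜 := ℂ) u u)
  rw [← L2.inner_def] at h1 h2
  have h3 : ‖u‖ ^ 2 = ∫ x, ‖u x‖ ^ 2 ∂μ := by
    rw [← inner_self_eq_norm_sq (𝕜 := ℂ) u, ← h2]
    simp only [inner_self_eq_norm_sq]
  have h4 : Integrable (fun x => ‖u x‖ ^ 2) μ := by
    simpa only [inner_self_eq_norm_sq] using (L2.integrable_inner (𝕜 := ℂ) u u).re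
  rw [h3, ← integral_const_mul]
  refine le_trans ?_ h1.le
  refine integral_mono_ae (h4.const_mul c) (L2.integrable_inner (𝕜 := ℂ) u (M u)).re ?_
  filter_upwards [hM u, hc] with x hx h
  simp only [hx]
  exact h _

end MulOp

/-! ### Real symmetric matrices acting on complex vectors -/

section MatrixCLM

variable {d : ℕ}

/-- A real matrix as an operator on `ℂ^d`. -/
def complexCLM (B : Matrix (Fin d) (Fin d) ℝ) :
    EuclideanSpace ℂ (Fin d) →L[ℂ] EuclideanSpace ℂ (Fin d) :=
  Matrix.toEuclideanCLM (𝕜 := ℂ) (B.map fun t : ℝ => (t : ℂ))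

theorem inner_complexCLM (B : Matrix (Fin d) (Fin d) ℝ) (ζ ξ : EuclideanSpace ℂ (Fin d)) :
    inner ℂ ζ (complexCLM B ξ) = ∑ i, ∑ j, (B i j : ℂ) * ξ j * conj (ζ i) := by
  simp only [complexCLM, PiLp.inner_apply, Matrix.ofLp_toEuclideanCLM, Matrix.mulVec, dotProduct,
    Matrix.map_apply, RCLike.inner_apply, Finset.sum_mul]

/-- Splitting $\xi$ into real and imaginary parts, the cross terms cancel by symmetry of $B$. Real
quadratic-form bounds therefore carry over to complex vectors. -/
theorem inner_complexCLM_self {B : Matrix (Fin d) (Fin d) ℝ} (hB : B.IsSymm)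
    (ξ : EuclideanSpace ℂ (Fin d)) :
    inner ℂ ξ (complexCLM B ξ) =
      (((fun i => (ξ i).re) ⬝ᵥ B.mulVec (fun i => (ξ i).re) +
        (fun i => (ξ i).im) ⬝ᵥ B.mulVec (fun i => (ξ i).im) : ℝ) : ℂ) := by
  rw [inner_complexCLM]
  apply Complex.ext
  · simp only [Complex.re_sum, Complex.ofReal_re, dotProduct, Matrix.mulVec, Finset.mul_sum,
      ← Finset.sum_add_distrib]
    refine Finset.sum_congr rfl fun i _ => Finset.sum_congr rfl fun j _ => ?_
    simp
    ring
  · rw [Complex.ofReal_im]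
    have h : (∑ i, ∑ j, (B i j : ℂ) * ξ j * conj (ξ i)).im =
        ∑ i, ∑ j, (B i j * (ξ j).im * (ξ i).re - B i j * (ξ j).re * (ξ i).im) := by
      simp only [Complex.im_sum]
      refine Finset.sum_congr rfl fun i _ => Finset.sum_congr rfl fun j _ => ?_
      simp
      ring
    rw [h]
    simp only [Finset.sum_sub_distrib]
    rw [sub_eq_zero, Finset.sum_comm]
    refine Finset.sum_congr rfl fun i _ => Finset.sum_congr rfl fun j _ => ?_
    rw [hB.apply i j]
    ring

theorem norm_sq_eq_dotProduct (ξ : EuclideanSpace ℂ (Fin d)) :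
    ‖ξ‖ ^ 2 = (fun i => (ξ i).re) ⬝ᵥ (fun i => (ξ i).re) +
      (fun i => (ξ i).im) ⬝ᵥ (fun i => (ξ i).im) := by
  rw [EuclideanSpace.norm_sq_eq]
  simp only [dotProduct, ← Finset.sum_add_distrib]
  refine Finset.sum_congr rfl fun i _ => ?_
  rw [← Complex.normSq_eq_norm_sq, Complex.normSq_apply]

theorem im_inner_complexCLM_self {B : Matrix (Fin d) (Fin d) ℝ} (hB : B.IsSymm)
    (ξ : EuclideanSpace ℂ (Fin d)) : (inner ℂ ξ (complexCLM B ξ)).im = 0 := by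
  rw [inner_complexCLM_self hB, Complex.ofReal_im]

theorem le_re_inner_complexCLM_self {B : Matrix (Fin d) (Fin d) ℝ} (hB : B.IsSymm) {b : ℝ}
    (hb : ∀ ξ : Fin d → ℝ, b * (ξ ⬝ᵥ ξ) ≤ ξ ⬝ᵥ B.mulVec ξ) (ξ : EuclideanSpace ℂ (Fin d)) :
    b * ‖ξ‖ ^ 2 ≤ (inner ℂ ξ (complexCLM B ξ)).re := by
  rw [inner_complexCLM_self hB, Complex.ofReal_re, norm_sq_eq_dotProduct, mul_add]
  exact add_le_add (hb _) (hb _)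

theorem re_inner_complexCLM_self_le {B : Matrix (Fin d) (Fin d) ℝ} (hB : B.IsSymm) {b : ℝ}
    (hb : ∀ ξ : Fin d → ℝ, ξ ⬝ᵥ B.mulVec ξ ≤ b * (ξ ⬝ᵥ ξ)) (ξ : EuclideanSpace ℂ (Fin d)) :
    (inner ℂ ξ (complexCLM B ξ)).re ≤ b * ‖ξ‖ ^ 2 := by
  rw [inner_complexCLM_self hB, Complex.ofReal_re, norm_sq_eq_dotProduct, mul_add]
  exact add_le_add (hb _) (hb _)

/-- An operator $T$ with $0\le T\le b$ in the C*-order has norm at most $b$. This turns the bounds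
on the quadratic form of $A$ into a bound on the sesquilinear term. -/
theorem norm_complexCLM_le {B : Matrix (Fin d) (Fin d) ℝ} (hB : B.IsSymm) {a b : ℝ} (ha : 0 ≤ a)
    (hb : 0 ≤ b) (h : ∀ ξ : Fin d → ℝ, a * (ξ ⬝ᵥ ξ) ≤ ξ ⬝ᵥ B.mulVec ξ ∧
      ξ ⬝ᵥ B.mulVec ξ ≤ b * (ξ ⬝ᵥ ξ)) : ‖complexCLM B‖ ≤ b := by
  have hsymm : ∀ ξ, inner ℂ (complexCLM B ξ) ξ = inner ℂ ξ (complexCLM B ξ) := fun ξ => by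
    rw [← inner_conj_symm, inner_complexCLM_self hB, Complex.conj_ofReal]
  refine (CStarAlgebra.norm_le_iff_le_algebraMap _ hb ?_).2 ?_
  · rw [ContinuousLinearMap.nonneg_iff_isPositive, ContinuousLinearMap.isPositive_iff_complex]
    intro ξ
    rw [hsymm]
    refine ⟨?_, (mul_nonneg ha (sq_nonneg _)).trans
      (le_re_inner_complexCLM_self hB (fun ξ => (h ξ).1) ξ)⟩
    rw [inner_complexCLM_self hB]
    simp
  · rw [ContinuousLinearMap.le_def, ContinuousLinearMap.isPositive_iff_complex]
    intro ξ
    have h1 : inner ℂ (((algebraMap ℝ (EuclideanSpace ℂ (Fin d) →L[ℂ] EuclideanSpace ℂ (Fin d))) b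
        - complexCLM B) ξ) ξ = ((b * ‖ξ‖ ^ 2 - (inner ℂ ξ (complexCLM B ξ)).re : ℝ) : ℂ) := by
      rw [sub_apply, inner_sub_left, hsymm, Algebra.algebraMap_eq_smul_one,
        smul_apply, one_apply_eq_self,
        ← Complex.coe_smul, inner_smul_left,
        inner_self_eq_norm_sq_to_K, inner_complexCLM_self hB]
      simp
    rw [h1]
    refine ⟨rfl, ?_⟩
    exact sub_nonneg.2 (re_inner_complexCLM_self_le hB (fun ξ => (h ξ).2) ξ)

theorem stronglyMeasurable_complexCLM {X : Type*} [MeasurableSpace X]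
    {A : X → Matrix (Fin d) (Fin d) ℝ} (hA : ∀ i j, Measurable fun x => A x i j) :
    StronglyMeasurable fun x => complexCLM (A x) := by
  have h : (fun x => complexCLM (A x)) = fun x => ∑ i, ∑ j, ((A x i j : ℝ) : ℂ) •
      Matrix.toEuclideanCLM (𝕜 := ℂ) (Matrix.single i j (1 : ℂ)) := by
    funext x
    rw [complexCLM, Matrix.matrix_eq_sum_single ((A x).map fun t : ℝ => (t : ℂ))]
    simp only [map_sum]
    refine Finset.sum_congr rfl fun i _ => Finset.sum_congr rfl fun j _ => ?_
    rw [← map_smul, Matrix.smul_single, smul_eq_mul, mul_one, Matrix.map_apply]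
  rw [h]
  refine Finset.stronglyMeasurable_fun_sum _ fun i _ =>
    Finset.stronglyMeasurable_fun_sum _ fun j _ => ?_
  exact (Complex.measurable_ofReal.comp (hA i j)).stronglyMeasurable.smul_const _

end MatrixCLM

/-! ### Operators representing the form -/

variable {d : ℕ} {D ΓD : Set (Space d)} {A : Space d → Matrix (Fin d) (Fin d) ℝ}
  {n : Space d → ℝ} {Amin Amax nmin nmax : ℝ}

theorem ip_eq_inner (u v : L2 D) : ip u v = inner ℂ v u := by
  rw [ip, L2.inner_def]
  rfl

/-- Bounded operators `SA`, `SN`, `SB` representing the three terms of the local form. -/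
structure IsFormRepr (ΓD : Set (Space d)) (A : Space d → Matrix (Fin d) (Fin d) ℝ)
    (n : Space d → ℝ) (Amin Amax nmin nmax : ℝ) (SA : L2Vec D →L[ℂ] L2Vec D)
    (SN : L2 D →L[ℂ] L2 D) (SB : L2Bdry D →L[ℂ] L2Bdry D) : Prop where
  form_eq : ∀ (k ε : ℝ) (η : ℂ) (u v : Triple D), form ΓD A n k ε η u v =
    inner ℂ (grad v) (SA (grad u)) - ((k : ℂ) ^ 2 + Complex.I * ε) * inner ℂ (fn v) (SN (fn u)) -
      Complex.I * η * inner ℂ (trace v) (SB (trace u))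
  norm_SA_le : ∀ G, ‖SA G‖ ≤ Amax * ‖G‖
  norm_SN_le : ∀ u, ‖SN u‖ ≤ nmax * ‖u‖
  norm_SB_le : ∀ g, ‖SB g‖ ≤ Real.sqrt nmax * ‖g‖
  im_SA : ∀ G, (inner ℂ G (SA G)).im = 0
  im_SN : ∀ u, (inner ℂ u (SN u)).im = 0
  im_SB : ∀ g, (inner ℂ g (SB g)).im = 0
  le_SA : ∀ G, Amin * ‖G‖ ^ 2 ≤ (inner ℂ G (SA G)).re
  le_SN : ∀ u, nmin * ‖u‖ ^ 2 ≤ (inner ℂ u (SN u)).re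
  SB_nonneg : ∀ g, 0 ≤ (inner ℂ g (SB g)).re

theorem CoeffBounds.nmin_le_nmax (h : CoeffBounds D ΓD A n Amin Amax nmin nmax)
    (hD : volume.restrict D ≠ 0) : nmin ≤ nmax := by
  have : NeZero (volume.restrict D) := ⟨hD⟩
  obtain ⟨x, hx⟩ := h.bounds_n.exists
  exact hx.1.trans hx.2

theorem CoeffBounds.Amin_le_Amax (h : CoeffBounds D ΓD A n Amin Amax nmin nmax)
    (hD : volume.restrict D ≠ 0) (hd : 0 < d) : Amin ≤ Amax := by
  have : NeZero (volume.restrict D) := ⟨hD⟩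
  obtain ⟨x, hx⟩ := h.bounds_A.exists
  have h1 := hx (Pi.single ⟨0, hd⟩ 1)
  have h2 : (Pi.single ⟨0, hd⟩ 1 : Fin d → ℝ) ⬝ᵥ Pi.single ⟨0, hd⟩ 1 = 1 := by simp
  rw [h2] at h1
  linarith [h1.1.trans h1.2]

theorem exists_isFormRepr (h : CoeffBounds D ΓD A n Amin Amax nmin nmax)
    (hΓ : MeasurableSet ΓD) (hA : 0 ≤ Amax) :
    ∃ SA SN SB, IsFormRepr (D := D) ΓD A n Amin Amax nmin nmax SA SN SB := by
  have hnorm : ∀ r : ℝ, ‖(r : ℂ) • ContinuousLinearMap.id ℂ ℂ‖ = |r| := fun r => by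
    rw [norm_smul, ContinuousLinearMap.norm_id, mul_one, Complex.norm_real, Real.norm_eq_abs]
  have hinner : ∀ (r : ℝ) (z : ℂ),
      inner ℂ z (((r : ℂ) • ContinuousLinearMap.id ℂ ℂ) z) = ((r * ‖z‖ ^ 2 : ℝ) : ℂ) := by
    intro r z
    rw [smul_apply, ContinuousLinearMap.id_apply, inner_smul_right,
      inner_self_eq_norm_sq_to_K]
    simp
  have hmeas : ∀ {ρ : Space d → ℝ}, Measurable ρ →
      StronglyMeasurable fun x => (ρ x : ℂ) • ContinuousLinearMap.id ℂ ℂ := fun hρ =>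
    (Complex.measurable_ofReal.comp hρ).stronglyMeasurable.smul_const _
  -- The indicator moves the restriction to the impedance boundary into the weight, so that `SB`
  -- acts on $L^2$ of the whole boundary, where traces live.
  set ρ : Space d → ℝ := ΓDᶜ.indicator fun x => Real.sqrt (n x) with hρdef
  have hρ : Measurable ρ := h.measurable_n.sqrt.indicator hΓ.compl
  have hρ0 : ∀ x, 0 ≤ ρ x := fun x => Set.indicator_nonneg (fun x _ => Real.sqrt_nonneg _) x
  have hμ : (surface d).restrict (frontier D \ ΓD) =
      ((surface d).restrict (frontier D)).restrict ΓDᶜ := by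
    rw [Measure.restrict_restrict hΓ.compl, Set.sdiff_eq, Set.inter_comm]
  have hρn : ∀ᵐ x ∂((surface d).restrict (frontier D)), ρ x ≤ Real.sqrt nmax := by
    have h1 := h.bounds_n_bdry
    rw [hμ, ae_restrict_iff' hΓ.compl] at h1
    filter_upwards [h1] with x hx
    by_cases hxΓ : x ∈ ΓDᶜ
    · rw [hρdef, Set.indicator_of_mem hxΓ]
      exact Real.sqrt_le_sqrt (hx hxΓ).2
    · rw [hρdef, Set.indicator_of_notMem hxΓ]
      exact Real.sqrt_nonneg _
  obtain ⟨SA, hSA, hSA'⟩ := exists_mulOp (μ := volume.restrict D) (fun x => complexCLM (A x))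
    (stronglyMeasurable_complexCLM h.measurable_A).aestronglyMeasurable (C := Amax) (by
      filter_upwards [h.symm_A, h.bounds_A] with x h1 h2
      exact norm_complexCLM_le h1 h.Amin_pos.le hA h2)
  obtain ⟨SN, hSN, hSN'⟩ := exists_mulOp (μ := volume.restrict D)
    (fun x => (n x : ℂ) • ContinuousLinearMap.id ℂ ℂ)
    (hmeas h.measurable_n).aestronglyMeasurable (C := nmax) (by
      filter_upwards [h.bounds_n] with x h1
      rw [hnorm, abs_of_nonneg (h.nmin_pos.le.trans h1.1)]
      exact h1.2)
  obtain ⟨SB, hSB, hSB'⟩ := exists_mulOp (μ := (surface d).restrict (frontier D))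
    (fun x => (ρ x : ℂ) • ContinuousLinearMap.id ℂ ℂ)
    (hmeas hρ).aestronglyMeasurable (C := Real.sqrt nmax) (by
      filter_upwards [hρn] with x h1
      rwa [hnorm, abs_of_nonneg (hρ0 x)])
  refine ⟨SA, SN, SB, ?_, hSA', hSN', hSB', ?_, ?_, ?_, ?_, ?_, ?_⟩
  · intro k ε η u v
    rw [form, inner_mulOp hSA, inner_mulOp hSN, inner_mulOp hSB, hμ,
      ← integral_indicator hΓ.compl]
    congr 1
    · simp only [inner_complexCLM]
      rfl
    · congr 1
      refine integral_congr_ae (Eventually.of_forall fun x => ?_)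
      by_cases hx : x ∈ ΓDᶜ
      · simp [hρdef, hx]
      · simp [hρdef, hx]
  · refine im_inner_mulOp_self hSA ?_
    filter_upwards [h.symm_A] with x h1 ξ
    exact im_inner_complexCLM_self h1 ξ
  · refine im_inner_mulOp_self hSN (Eventually.of_forall fun x ξ => ?_)
    rw [hinner, Complex.ofReal_im]
  · refine im_inner_mulOp_self hSB (Eventually.of_forall fun x ξ => ?_)
    rw [hinner, Complex.ofReal_im]
  · refine le_re_inner_mulOp_self hSA ?_
    filter_upwards [h.symm_A, h.bounds_A] with x h1 h2 ξ
    exact le_re_inner_complexCLM_self h1 (fun ξ => (h2 ξ).1) ξ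
  · refine le_re_inner_mulOp_self hSN ?_
    filter_upwards [h.bounds_n] with x h1 ξ
    rw [hinner, Complex.ofReal_re]
    exact mul_le_mul_of_nonneg_right h1.1 (sq_nonneg _)
  · intro g
    have := le_re_inner_mulOp_self hSB (c := 0) (Eventually.of_forall fun x ξ => by
      rw [hinner, Complex.ofReal_re, zero_mul]
      exact mul_nonneg (hρ0 x) (sq_nonneg _)) g
    simpa using this

end

/-! ### Closedness and conjugation invariance of the Sobolev spaces. -/

section

variable {d : ℕ} {D ΓD : Set (Space d)}

/-! ### Closedness of the Sobolev spaces -/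

theorem continuous_integral_mul_test {μ : Measure (Space d)} [IsFiniteMeasureOnCompacts μ]
    {ψ : Space d → ℝ} (hψ : Continuous ψ) (hc : HasCompactSupport ψ) :
    Continuous fun u : Lp ℂ 2 μ => ∫ x, u x * (ψ x : ℂ) ∂μ := by
  have h1 : Continuous fun x => (ψ x : ℂ) := Complex.continuous_ofReal.comp hψ
  have h2 : HasCompactSupport fun x => (ψ x : ℂ) :=
    hc.comp_left (g := fun t : ℝ => (t : ℂ)) Complex.ofReal_zero
  have h3 : MemLp (fun x => (ψ x : ℂ)) 2 μ := h1.memLp_of_hasCompactSupport h2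
  have h4 : (fun u : Lp ℂ 2 μ => ∫ x, u x * (ψ x : ℂ) ∂μ) = fun u => inner ℂ (h3.toLp _) u := by
    funext u
    rw [L2.inner_def]
    refine integral_congr_ae ?_
    filter_upwards [h3.coeFn_toLp] with x hx
    rw [hx, RCLike.inner_apply, Complex.conj_ofReal]
  rw [h4]
  exact continuous_const.inner continuous_id

theorem isClosed_isWeakGrad : IsClosed {w : Triple D | IsWeakGrad (fn w) (grad w)} := by
  simp only [IsWeakGrad, Set.ofPred_forall]
  refine isClosed_iInter fun φ => isClosed_iInter fun h1 => isClosed_iInter fun h2 =>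
    isClosed_iInter fun _ => isClosed_iInter fun i => isClosed_eq ?_ ?_
  · exact (continuous_integral_mul_test (continuous_partial h1 _)
      (h2.fderiv_apply ℝ (EuclideanSpace.single i (1 : ℝ)))).comp continuous_fst
  · have h3 := continuous_integral_mul_test (μ := volume.restrict D) h1.continuous h2
    have h4 : (fun w : Triple D => -∫ x in D, grad w x i * (φ x : ℂ)) = fun w =>
        -∫ x in D, ((EuclideanSpace.proj (𝕜 := ℂ) i).compLpL 2 (volume.restrict D) (grad w)) x *
          (φ x : ℂ) := by
      funext w
      congr 1
      refine integral_congr_ae ?_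
      filter_upwards [ContinuousLinearMap.coeFn_compLpL (EuclideanSpace.proj (𝕜 := ℂ) i) (grad w)]
        with x hx
      simp only [hx]
      rfl
    rw [h4]
    exact (h3.comp ((ContinuousLinearMap.continuous _).comp
      (continuous_fst.comp continuous_snd))).neg

/-- The sequence is replaced by approximation to every tolerance, so that closedness needs no
diagonal sequence. -/
theorem isTrace_iff {u : L2 D} {G : L2Vec D} {g : L2Bdry D} :
    IsTrace u G g ↔ ∀ δ : ℝ≥0∞, 0 < δ → ∃ φ : Space d → ℂ, ContDiff ℝ ∞ φ ∧
      eLpNorm (fun x => φ x - u x) 2 (volume.restrict D) < δ ∧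
      eLpNorm (fun x => classicalGrad φ x - G x) 2 (volume.restrict D) < δ ∧
      eLpNorm (fun x => φ x - g x) 2 ((surface d).restrict (frontier D)) < δ := by
  constructor
  · rintro ⟨φ, h0, h1, h2, h3⟩ δ hδ
    obtain ⟨m, e1, e2, e3⟩ := ((h1.eventually_lt_const hδ).and
      ((h2.eventually_lt_const hδ).and (h3.eventually_lt_const hδ))).exists
    exact ⟨φ m, h0 m, e1, e2, e3⟩
  · intro h
    choose φ h0 h1 h2 h3 using fun m : ℕ =>
      h (m : ℝ≥0∞)⁻¹ (ENNReal.inv_pos.2 (ENNReal.natCast_ne_top m))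
    have key : ∀ {a : ℕ → ℝ≥0∞}, (∀ m, a m < (m : ℝ≥0∞)⁻¹) → Tendsto a atTop (𝓝 0) := fun ha =>
      tendsto_of_tendsto_of_tendsto_of_le_of_le tendsto_const_nhds
        ENNReal.tendsto_inv_nat_nhds_zero (fun _ => zero_le) fun m => (ha m).le
    exact ⟨φ, h0, key h1, key h2, key h3⟩

theorem eLpNorm_sub_coe_lt {F : Type*} [NormedAddCommGroup F] {μ : Measure (Space d)}
    {f : Space d → F} (hf : AEStronglyMeasurable f μ) {u v : Lp F 2 μ} {δ : ℝ≥0∞}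
    (h : eLpNorm (fun x => f x - v x) 2 μ < δ / 2) (huv : edist u v < δ / 2) :
    eLpNorm (fun x => f x - u x) 2 μ < δ := by
  have h1 : (fun x => f x - u x) = (fun x => f x - v x) + (⇑v - ⇑u) := by
    funext x
    simp
  rw [h1]
  refine (eLpNorm_add_le (hf.sub (Lp.aestronglyMeasurable v))
    ((Lp.aestronglyMeasurable v).sub (Lp.aestronglyMeasurable u)) (by norm_num)).trans_lt ?_
  rw [← Lp.edist_def, edist_comm, ← ENNReal.add_halves δ]
  exact ENNReal.add_lt_add h huv

theorem isClosed_isTrace : IsClosed {w : Triple D | IsTrace (fn w) (grad w) (trace w)} := by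
  refine isClosed_of_closure_subset fun w hw => ?_
  rw [Set.mem_ofPred_eq, isTrace_iff]
  intro δ hδ
  obtain ⟨v, hv, hwv⟩ := EMetric.mem_closure_iff.1 hw (δ / 2) (ENNReal.half_pos hδ.ne')
  obtain ⟨φ, h0, h1, h2, h3⟩ := isTrace_iff.1 hv (δ / 2) (ENNReal.half_pos hδ.ne')
  have e1 : edist w.1 v.1 < δ / 2 := (le_max_left _ _).trans_lt hwv
  have e2 : edist w.2 v.2 < δ / 2 := (le_max_right _ _).trans_lt hwv
  exact ⟨φ, h0, eLpNorm_sub_coe_lt h0.continuous.aestronglyMeasurable h1 e1,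
    eLpNorm_sub_coe_lt (continuous_classicalGrad h0).aestronglyMeasurable h2
      ((le_max_left _ _).trans_lt e2),
    eLpNorm_sub_coe_lt h0.continuous.aestronglyMeasurable h3 ((le_max_right _ _).trans_lt e2)⟩

theorem isClosed_ae_eq_zero_on (hΓ : MeasurableSet ΓD) {μ : Measure (Space d)} :
    IsClosed {g : Lp ℂ 2 μ | ∀ᵐ x ∂μ, x ∈ ΓD → g x = 0} := by
  refine isClosed_of_closure_subset fun g hg => ?_
  have h0 : eLpNorm g 2 (μ.restrict ΓD) = 0 := by
    refine le_antisymm (le_of_forall_gt fun δ hδ => ?_) zero_le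
    obtain ⟨h, hh, hgh⟩ := EMetric.mem_closure_iff.1 hg δ hδ
    have h1 : eLpNorm g 2 (μ.restrict ΓD) = eLpNorm (⇑g - ⇑h) 2 (μ.restrict ΓD) := by
      refine eLpNorm_congr_ae ?_
      filter_upwards [(ae_restrict_iff' hΓ).2 hh] with x hx
      rw [Pi.sub_apply, hx, sub_zero]
    rw [h1]
    exact (eLpNorm_mono_measure _ Measure.restrict_le_self).trans_lt (Lp.edist_def g h ▸ hgh)
  rw [eLpNorm_eq_zero_iff ((Lp.aestronglyMeasurable g).mono_measure Measure.restrict_le_self)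
    (by norm_num)] at h0
  exact (ae_restrict_iff' hΓ).1 h0

/-- Lax–Milgram needs a complete space. All three defining conditions pass to limits because
gradient and trace are components of the triple. -/
theorem isClosed_H10 (hΓ : MeasurableSet ΓD) : IsClosed (H10 D ΓD : Set (Triple D)) := by
  have h : (H10 D ΓD : Set (Triple D)) = ({w : Triple D | IsWeakGrad (fn w) (grad w)} ∩
      {w : Triple D | IsTrace (fn w) (grad w) (trace w)}) ∩ trace ⁻¹'
        {g | ∀ᵐ x ∂((surface d).restrict (frontier D)), x ∈ ΓD → g x = 0} := rfl
  rw [h]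
  exact (isClosed_isWeakGrad.inter isClosed_isTrace).inter
    ((isClosed_ae_eq_zero_on hΓ).preimage (continuous_snd.comp continuous_snd))

/-! ### Complex conjugation -/

/-- Componentwise complex conjugation. -/
def conjVec (ξ : EuclideanSpace ℂ (Fin d)) : EuclideanSpace ℂ (Fin d) :=
  WithLp.toLp 2 fun i => conj (ξ i)

theorem conjVec_sub (ξ ζ : EuclideanSpace ℂ (Fin d)) :
    conjVec (ξ - ζ) = conjVec ξ - conjVec ζ := by
  ext i
  simp [conjVec]

theorem norm_conjVec (ξ : EuclideanSpace ℂ (Fin d)) : ‖conjVec ξ‖ = ‖ξ‖ := by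
  simp [conjVec, EuclideanSpace.norm_eq]

theorem lipschitzWith_conjVec : LipschitzWith 1 (conjVec (d := d)) :=
  LipschitzWith.of_dist_le_mul fun ξ ζ => by
    rw [dist_eq_norm, dist_eq_norm, ← conjVec_sub, norm_conjVec]
    simp

theorem lipschitzWith_conj : LipschitzWith 1 (fun z : ℂ => conj z) :=
  Complex.isometry_conj.lipschitz

/-- Pointwise complex conjugation on scalar `L²`. -/
def conjLp {μ : Measure (Space d)} (u : Lp ℂ 2 μ) : Lp ℂ 2 μ :=
  lipschitzWith_conj.compLp (map_zero _) u

/-- Pointwise complex conjugation on vector-valued `L²`. -/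
def conjLpVec {μ : Measure (Space d)} (G : Lp (EuclideanSpace ℂ (Fin d)) 2 μ) :
    Lp (EuclideanSpace ℂ (Fin d)) 2 μ :=
  lipschitzWith_conjVec.compLp (by ext i; simp [conjVec]) G

variable {μ : Measure (Space d)}

theorem coeFn_conjLp (u : Lp ℂ 2 μ) : ∀ᵐ x ∂μ, conjLp u x = conj (u x) :=
  LipschitzWith.coeFn_compLp _ _ _

theorem coeFn_conjLpVec (G : Lp (EuclideanSpace ℂ (Fin d)) 2 μ) :
    ∀ᵐ x ∂μ, conjLpVec G x = conjVec (G x) :=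
  LipschitzWith.coeFn_compLp _ _ _

theorem conjLp_conjLp (u : Lp ℂ 2 μ) : conjLp (conjLp u) = u := by
  refine Lp.ext ?_
  filter_upwards [coeFn_conjLp u, coeFn_conjLp (conjLp u)] with x h1 h2
  rw [h2, h1, Complex.conj_conj]

theorem conjLpVec_conjLpVec (G : Lp (EuclideanSpace ℂ (Fin d)) 2 μ) :
    conjLpVec (conjLpVec G) = G := by
  refine Lp.ext ?_
  filter_upwards [coeFn_conjLpVec G, coeFn_conjLpVec (conjLpVec G)] with x h1 h2
  rw [h2, h1]
  ext i
  simp [conjVec]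

theorem norm_conjLp (u : Lp ℂ 2 μ) : ‖conjLp u‖ = ‖u‖ := by
  rw [Lp.norm_def, Lp.norm_def]
  congr 1
  refine eLpNorm_congr_norm_ae ?_
  filter_upwards [coeFn_conjLp u] with x hx
  rw [hx, RCLike.norm_conj]

theorem norm_conjLpVec (G : Lp (EuclideanSpace ℂ (Fin d)) 2 μ) : ‖conjLpVec G‖ = ‖G‖ := by
  rw [Lp.norm_def, Lp.norm_def]
  congr 1
  refine eLpNorm_congr_norm_ae ?_
  filter_upwards [coeFn_conjLpVec G] with x hx
  rw [hx, norm_conjVec]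

/-- Complex conjugate of a Sobolev function. -/
def conjTriple (w : Triple D) : Triple D := (conjLp (fn w), conjLpVec (grad w), conjLp (trace w))

theorem conjTriple_conjTriple (w : Triple D) : conjTriple (conjTriple w) = w :=
  Prod.ext (conjLp_conjLp _) (Prod.ext (conjLpVec_conjLpVec _) (conjLp_conjLp _))

theorem energyNorm_conjTriple (k : ℝ) (w : Triple D) :
    energyNorm k (conjTriple w) = energyNorm k w := by
  rw [energyNorm, energyNorm]
  congr 3
  · rw [show grad (conjTriple w) = conjLpVec (grad w) from rfl, norm_conjLpVec]
  · rw [show fn (conjTriple w) = conjLp (fn w) from rfl, norm_conjLp]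

theorem IsWeakGrad.conj {u : L2 D} {G : L2Vec D} (h : IsWeakGrad u G) :
    IsWeakGrad (conjLp u) (conjLpVec G) := by
  intro φ h1 h2 h3 i
  have e := congrArg conj (h φ h1 h2 h3 i)
  rw [map_neg, ← integral_conj, ← integral_conj] at e
  refine Eq.trans (integral_congr_ae ?_) (e.trans (congrArg Neg.neg (integral_congr_ae ?_)))
  · filter_upwards [coeFn_conjLp u] with x hx
    rw [hx, map_mul, Complex.conj_ofReal]
  · filter_upwards [coeFn_conjLpVec G] with x hx
    rw [hx, map_mul, Complex.conj_ofReal]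
    rfl

theorem classicalGrad_conj {φ : Space d → ℂ} (hφ : ContDiff ℝ ∞ φ) (x : Space d) :
    classicalGrad (fun y => conj (φ y)) x = conjVec (classicalGrad φ x) := by
  have h : fderiv ℝ (fun y => conj (φ y)) x =
      (Complex.conjCLE : ℂ →L[ℝ] ℂ).comp (fderiv ℝ φ x) :=
    (Complex.conjCLE.hasFDerivAt.comp x (hφ.differentiable (by simp) x).hasFDerivAt).fderiv
  ext i
  simp [classicalGrad, conjVec, h]

theorem IsTrace.conj {u : L2 D} {G : L2Vec D} {g : L2Bdry D} (h : IsTrace u G g) :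
    IsTrace (conjLp u) (conjLpVec G) (conjLp g) := by
  have key : ∀ {μ : Measure (Space d)} (v : Lp ℂ 2 μ) (f : Space d → ℂ),
      eLpNorm (fun x => conj (f x) - conjLp v x) 2 μ = eLpNorm (fun x => f x - v x) 2 μ := by
    intro μ v f
    refine eLpNorm_congr_norm_ae ?_
    filter_upwards [coeFn_conjLp v] with x hx
    rw [hx, ← map_sub, RCLike.norm_conj]
  obtain ⟨φ, h0, h1, h2, h3⟩ := h
  refine ⟨fun m x => conj (φ m x), fun m => Complex.conjCLE.contDiff.comp (h0 m), ?_, ?_, ?_⟩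
  · simpa only [key] using h1
  · refine h2.congr fun m => eLpNorm_congr_norm_ae ?_
    filter_upwards [coeFn_conjLpVec G] with x hx
    rw [hx, classicalGrad_conj (h0 m), ← conjVec_sub, norm_conjVec]
  · simpa only [key] using h3

theorem conjTriple_mem_H10 {w : Triple D} (hw : w ∈ H10 D ΓD) : conjTriple w ∈ H10 D ΓD := by
  refine ⟨⟨hw.1.1.conj, hw.1.2.conj⟩, ?_⟩
  filter_upwards [hw.2, coeFn_conjLp (trace w)] with x h1 h2 hx
  exact h2.trans (by rw [h1 hx, map_zero])

variable {A : Space d → Matrix (Fin d) (Fin d) ℝ} {n : Space d → ℝ} {k ε : ℝ} {η : ℂ}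

theorem ip_conjLp_left (u v : L2 D) : ip (conjLp u) v = ip (conjLp v) u := by
  refine integral_congr_ae ?_
  filter_upwards [coeFn_conjLp u, coeFn_conjLp v] with x h1 h2
  rw [h1, h2, mul_comm]

/-- The bilinear form $(u,v)\mapsto a(u,\bar v)$ is symmetric, since $A$ is symmetric and the other
two terms are scalar products with weights. Hence conjugation interchanges the direct and adjoint
problems, without conjugating $k^2+\mathrm i\varepsilon$ or $\eta$. -/
theorem form_conjTriple_left (hA : ∀ᵐ x ∂(volume.restrict D), (A x).IsSymm) (u v : Triple D) :
    form ΓD A n k ε η (conjTriple u) v = form ΓD A n k ε η (conjTriple v) u := by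
  have h1 : ∫ x in D, ∑ i, ∑ j, (A x i j : ℂ) * grad (conjTriple u) x j * conj (grad v x i) =
      ∫ x in D, ∑ i, ∑ j, (A x i j : ℂ) * grad (conjTriple v) x j * conj (grad u x i) := by
    refine integral_congr_ae ?_
    filter_upwards [hA, coeFn_conjLpVec (grad u), coeFn_conjLpVec (grad v)] with x h h1 h2
    rw [Finset.sum_comm]
    refine Finset.sum_congr rfl fun i _ => Finset.sum_congr rfl fun j _ => ?_
    change (A x j i : ℂ) * conjLpVec (grad u) x i * conj (grad v x j) =
      (A x i j : ℂ) * conjLpVec (grad v) x j * conj (grad u x i)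
    rw [h1, h2, h.apply i j]
    simp only [conjVec]
    ring
  have h2 : ∫ x in D, (n x : ℂ) * fn (conjTriple u) x * conj (fn v x) =
      ∫ x in D, (n x : ℂ) * fn (conjTriple v) x * conj (fn u x) := by
    refine integral_congr_ae ?_
    filter_upwards [coeFn_conjLp (fn u), coeFn_conjLp (fn v)] with x h1 h2
    change (n x : ℂ) * conjLp (fn u) x * conj (fn v x) =
      (n x : ℂ) * conjLp (fn v) x * conj (fn u x)
    rw [h1, h2]
    ring
  have h3 : ∫ x in frontier D \ ΓD, (Real.sqrt (n x) : ℂ) * trace (conjTriple u) x *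
        conj (trace v x) ∂(surface d) =
      ∫ x in frontier D \ ΓD, (Real.sqrt (n x) : ℂ) * trace (conjTriple v) x *
        conj (trace u x) ∂(surface d) := by
    refine integral_congr_ae ?_
    have hle : (surface d).restrict (frontier D \ ΓD) ≤ (surface d).restrict (frontier D) :=
      Measure.restrict_mono Set.sdiff_subset le_rfl
    filter_upwards [ae_mono hle (coeFn_conjLp (trace u)), ae_mono hle (coeFn_conjLp (trace v))]
      with x h1 h2
    change (Real.sqrt (n x) : ℂ) * conjLp (trace u) x * conj (trace v x) =
      (Real.sqrt (n x) : ℂ) * conjLp (trace v) x * conj (trace u x)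
    rw [h1, h2]
    ring
  rw [form, form, h1, h2, h3]

theorem IsAdjointSolution.conj (hA : ∀ᵐ x ∂(volume.restrict D), (A x).IsSymm) {f : L2 D}
    {s : Triple D} (h : IsAdjointSolution ΓD A n k ε η f s) :
    IsLocalSolution ΓD A n k ε η (conjLp f) (conjTriple s) := by
  refine ⟨conjTriple_mem_H10 h.1, fun v hv => ?_⟩
  rw [form_conjTriple_left hA, h.2 _ (conjTriple_mem_H10 hv)]
  exact ip_conjLp_left _ _

theorem IsLocalSolution.conj (hA : ∀ᵐ x ∂(volume.restrict D), (A x).IsSymm) {f : L2 D}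
    {u : Triple D} (h : IsLocalSolution ΓD A n k ε η f u) :
    IsAdjointSolution ΓD A n k ε η (conjLp f) (conjTriple u) := by
  refine ⟨conjTriple_mem_H10 h.1, fun v hv => ?_⟩
  have h1 := form_conjTriple_left (ΓD := ΓD) (n := n) (k := k) (ε := ε) (η := η) hA
    (conjTriple v) (conjTriple u)
  rw [conjTriple_conjTriple, conjTriple_conjTriple] at h1
  rw [h1, h.2 _ (conjTriple_mem_H10 hv)]
  have h2 := ip_conjLp_left (conjLp f) (conjLp (fn v))
  rwa [conjLp_conjLp, conjLp_conjLp] at h2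

end

/-! ### Coercivity under absorption and solvability of the local problem. -/

section

variable {d : ℕ} {D ΓD : Set (Space d)} {A : Space d → Matrix (Fin d) (Fin d) ℝ}
  {n : Space d → ℝ} {Amin Amax nmin nmax k ε : ℝ} {η : ℂ} {SA : L2Vec D →L[ℂ] L2Vec D}
  {SN : L2 D →L[ℂ] L2 D} {SB : L2Bdry D →L[ℂ] L2Bdry D}

/-! ### The energy norm -/

theorem energyNorm_nonneg (k : ℝ) (w : Triple D) : 0 ≤ energyNorm k w := Real.sqrt_nonneg _

theorem energyNorm_sq (k : ℝ) (w : Triple D) :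
    energyNorm k w ^ 2 = ‖grad w‖ ^ 2 + k ^ 2 * ‖fn w‖ ^ 2 :=
  Real.sq_sqrt (by positivity)

theorem norm_mul_norm_add_le_energyNorm (k : ℝ) (v w : Triple D) :
    ‖grad v‖ * ‖grad w‖ + k ^ 2 * (‖fn v‖ * ‖fn w‖) ≤ energyNorm k v * energyNorm k w := by
  refine le_of_sq_le_sq ?_ (mul_nonneg (energyNorm_nonneg k v) (energyNorm_nonneg k w))
  rw [mul_pow, energyNorm_sq, energyNorm_sq]
  nlinarith [sq_nonneg (k * (‖grad v‖ * ‖fn w‖ - ‖grad w‖ * ‖fn v‖))]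

theorem energyNorm_add_le (k : ℝ) (v w : Triple D) :
    energyNorm k (v + w) ≤ energyNorm k v + energyNorm k w := by
  refine le_of_sq_le_sq ?_ (add_nonneg (energyNorm_nonneg k v) (energyNorm_nonneg k w))
  have h1 : ‖grad (v + w)‖ ^ 2 ≤ (‖grad v‖ + ‖grad w‖) ^ 2 :=
    pow_le_pow_left₀ (norm_nonneg _) (norm_add_le (grad v) (grad w)) 2
  have h2 : k ^ 2 * ‖fn (v + w)‖ ^ 2 ≤ k ^ 2 * (‖fn v‖ + ‖fn w‖) ^ 2 :=
    mul_le_mul_of_nonneg_left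
      (pow_le_pow_left₀ (norm_nonneg _) (norm_add_le (fn v) (fn w)) 2) (sq_nonneg _)
  have h3 := norm_mul_norm_add_le_energyNorm k v w
  rw [add_sq, energyNorm_sq, energyNorm_sq, energyNorm_sq]
  linarith

theorem energyNorm_neg (k : ℝ) (w : Triple D) : energyNorm k (-w) = energyNorm k w := by
  simp [energyNorm, fn, grad]

theorem mul_norm_fn_le_energyNorm (k : ℝ) (w : Triple D) : k * ‖fn w‖ ≤ energyNorm k w := by
  refine Real.le_sqrt_of_sq_le ?_
  rw [mul_pow]
  exact le_add_of_nonneg_left (sq_nonneg _)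

theorem norm_grad_le_energyNorm (w : Triple D) : ‖grad w‖ ≤ energyNorm k w :=
  Real.le_sqrt_of_sq_le (le_add_of_nonneg_right (by positivity))

/-! ### The impedance parameter -/

theorem sgn_mul_self (ε : ℝ) : sgn ε * sgn ε = 1 := by
  unfold sgn
  split_ifs <;> norm_num

theorem sgn_mul_eq_abs (ε : ℝ) : sgn ε * ε = |ε| := by
  unfold sgn
  split_ifs with h
  · rw [one_mul, abs_of_nonneg h]
  · rw [abs_of_neg (not_le.1 h), neg_one_mul]

/-- These two signs are all that is used about $\eta$. For the square root, half the argument lies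
in $[-\pi/2,\pi/2]$ and has the sign of $\varepsilon$, so the factor `sgn ε` makes the imaginary
part nonnegative. -/
theorem IsImpedanceParameter.nonneg (h : IsImpedanceParameter k ε η) (hk : 0 < k) :
    0 ≤ η.im ∧ 0 ≤ sgn ε * η.re := by
  rcases h with rfl | rfl
  · rw [Complex.ofReal_im, Complex.ofReal_re, ← mul_assoc, sgn_mul_self, one_mul]
    exact ⟨le_rfl, hk.le⟩
  · set z : ℂ := (k : ℂ) ^ 2 + Complex.I * ε with hz
    have hzre : z.re = k ^ 2 := by simp [hz, ← Complex.ofReal_pow]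
    have hzim : z.im = ε := by simp [hz, ← Complex.ofReal_pow]
    have hz0 : z ≠ 0 := fun h => by
      rw [h, Complex.zero_re] at hzre
      exact (pow_pos hk 2).ne hzre
    have hw : z ^ (1 / 2 : ℂ) = Complex.exp (Complex.log z / 2) := by
      rw [Complex.cpow_def_of_ne_zero hz0]
      congr 1
      ring
    have him : (Complex.log z / 2).im = z.arg / 2 := by
      rw [show (2 : ℂ) = ((2 : ℝ) : ℂ) by norm_num, Complex.div_ofReal_im, Complex.log_im]
    have hpi := Complex.abs_arg_le_pi z
    rw [abs_le] at hpi
    rw [hw, Complex.re_ofReal_mul, Complex.im_ofReal_mul, Complex.exp_re, Complex.exp_im, him,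
      ← mul_assoc (sgn ε) (sgn ε), sgn_mul_self, one_mul]
    refine ⟨?_, mul_nonneg (Real.exp_nonneg _)
      (Real.cos_nonneg_of_neg_pi_div_two_le_of_le (by linarith) (by linarith))⟩
    rw [mul_left_comm]
    refine mul_nonneg (Real.exp_nonneg _) ?_
    unfold sgn
    split_ifs with hε
    · have : 0 ≤ z.arg := Complex.arg_nonneg_iff.2 (by rwa [hzim])
      rw [one_mul]
      exact Real.sin_nonneg_of_nonneg_of_le_pi (by linarith) (by linarith)
    · have : z.arg < 0 := Complex.arg_neg_iff.2 (by rw [hzim]; exact not_le.1 hε)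
      rw [neg_one_mul, neg_nonneg]
      exact Real.sin_nonpos_of_nonpos_of_neg_pi_le (by linarith) (by linarith)

/-! ### Algebra of the form -/

namespace IsFormRepr

variable (R : IsFormRepr (D := D) ΓD A n Amin Amax nmin nmax SA SN SB)
include R

theorem form_add_left (u u' v : Triple D) : form ΓD A n k ε η (u + u') v =
    form ΓD A n k ε η u v + form ΓD A n k ε η u' v := by
  simp only [R.form_eq, fn, grad, trace, Prod.fst_add, Prod.snd_add, map_add, inner_add_right]
  ring

theorem form_smul_left (c : ℂ) (u v : Triple D) : form ΓD A n k ε η (c • u) v =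
    c * form ΓD A n k ε η u v := by
  simp only [R.form_eq, fn, grad, trace, Prod.smul_fst, Prod.smul_snd, map_smul, inner_smul_right]
  ring

theorem form_add_right (u v v' : Triple D) : form ΓD A n k ε η u (v + v') =
    form ΓD A n k ε η u v + form ΓD A n k ε η u v' := by
  simp only [R.form_eq, fn, grad, trace, Prod.fst_add, Prod.snd_add, inner_add_left]
  ring

theorem form_smul_right (c : ℂ) (u v : Triple D) : form ΓD A n k ε η u (c • v) =
    conj c * form ΓD A n k ε η u v := by
  simp only [R.form_eq, fn, grad, trace, Prod.smul_fst, Prod.smul_snd, inner_smul_left]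
  ring

theorem form_sub_left (u u' v : Triple D) : form ΓD A n k ε η (u - u') v =
    form ΓD A n k ε η u v - form ΓD A n k ε η u' v := by
  rw [sub_eq_add_neg, ← neg_one_smul ℂ u', R.form_add_left, R.form_smul_left]
  ring

theorem form_sub_right (u v v' : Triple D) : form ΓD A n k ε η u (v - v') =
    form ΓD A n k ε η u v - form ΓD A n k ε η u v' := by
  rw [sub_eq_add_neg, ← neg_one_smul ℂ v', R.form_add_right, R.form_smul_right]
  simp
  ring

/-- Changing the absorption parameter changes the form by a zeroth-order term. -/
theorem form_absorption (ε' : ℝ) (u v : Triple D) : form ΓD A n k ε η u v =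
    form ΓD A n k ε' η u v + Complex.I * (ε' - ε : ℝ) * inner ℂ (fn v) (SN (fn u)) := by
  rw [R.form_eq, R.form_eq]
  push_cast
  ring

/-- A combination of the real and the imaginary part of the form on the diagonal. -/
theorem energy_le_re_sub_im {s t : ℝ} (hε : 2 * k ^ 2 ≤ t * (s * ε)) (him : 0 ≤ η.im)
    (hre : 0 ≤ t * (s * η.re)) (hα : 0 ≤ nmin) (u : Triple D) :
    min Amin nmin * energyNorm k u ^ 2 ≤
      (form ΓD A n k ε η u u).re - t * s * (form ΓD A n k ε η u u).im := by
  obtain ⟨X, hX⟩ : ∃ X : ℝ, inner ℂ (grad u) (SA (grad u)) = (X : ℂ) :=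
    ⟨_, Complex.ext rfl (R.im_SA _)⟩
  obtain ⟨Y, hY⟩ : ∃ Y : ℝ, inner ℂ (fn u) (SN (fn u)) = (Y : ℂ) :=
    ⟨_, Complex.ext rfl (R.im_SN _)⟩
  obtain ⟨Z, hZ⟩ : ∃ Z : ℝ, inner ℂ (trace u) (SB (trace u)) = (Z : ℂ) :=
    ⟨_, Complex.ext rfl (R.im_SB _)⟩
  have hX' := R.le_SA (grad u)
  have hY' := R.le_SN (fn u)
  have hZ' := R.SB_nonneg (trace u)
  rw [hX, Complex.ofReal_re] at hX'
  rw [hY, Complex.ofReal_re] at hY'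
  rw [hZ, Complex.ofReal_re] at hZ'
  have e1 : (form ΓD A n k ε η u u).re = X - k ^ 2 * Y + η.im * Z := by
    rw [R.form_eq, hX, hY, hZ]
    simp [← Complex.ofReal_pow]
  have e2 : (form ΓD A n k ε η u u).im = -(ε * Y) - η.re * Z := by
    rw [R.form_eq, hX, hY, hZ]
    simp [← Complex.ofReal_pow]
  have hY0 : 0 ≤ Y := (mul_nonneg hα (sq_nonneg _)).trans hY'
  have h1 : min Amin nmin * ‖grad u‖ ^ 2 ≤ X :=
    (mul_le_mul_of_nonneg_right (min_le_left _ _) (sq_nonneg _)).trans hX'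
  have h2 : k ^ 2 * (min Amin nmin * ‖fn u‖ ^ 2) ≤ k ^ 2 * Y :=
    mul_le_mul_of_nonneg_left ((mul_le_mul_of_nonneg_right (min_le_right _ _)
      (sq_nonneg _)).trans hY') (sq_nonneg _)
  have h3 := mul_le_mul_of_nonneg_right hε hY0
  have h4 := mul_nonneg him hZ'
  have h5 := mul_nonneg hre hZ'
  -- The combination equals
  -- $X+(ts\varepsilon-k^2)Y+(\operatorname{Im}\eta+ts\operatorname{Re}\eta)Z$. The condition
  -- $ts\varepsilon\ge2k^2$ makes the middle coefficient at least $k^2$, and the boundary term is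
  -- nonnegative.
  rw [e1, e2, energyNorm_sq]
  linarith

end IsFormRepr

/-! ### Traces and energy -/

/-- A constant in the trace inequality carries no sign by itself; one function with nonzero `fn`
forces it. -/
theorem IsTraceConstant.nonneg_of_ne_zero {L C : ℝ} (h : IsTraceConstant D L C) (hL : 0 < L)
    {w : Triple D} (hw : w ∈ H1 D) (h0 : fn w ≠ 0) : 0 ≤ C := by
  have h1 : 0 < ‖fn w‖ := norm_pos_iff.2 h0
  have h2 : 0 < ‖fn w‖ * (L⁻¹ * ‖fn w‖ + ‖grad w‖) := by positivity
  have h3 := (sq_nonneg _).trans (h w hw)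
  rw [mul_assoc] at h3
  exact nonneg_of_mul_nonneg_left h3 h2

/-- Young's inequality $k\|w\|\|\nabla w\|\le\frac12\|w\|_{1,k}^2$ gives the summand $\frac12$, and
$kL^{-1}\|w\|^2=\frac1{kL}k^2\|w\|^2$ gives the other one. This is the boundary part of the
continuity constant. -/
theorem IsTraceConstant.trace_sq_le {L C : ℝ} (h : IsTraceConstant D L C) (hL : 0 < L)
    (hC : 0 ≤ C) (hk : 0 < k) {w : Triple D} (hw : w ∈ H1 D) :
    ‖trace w‖ ^ 2 ≤ C / k * (1 / 2 + 1 / (k * L)) * energyNorm k w ^ 2 := by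
  refine (h w hw).trans ?_
  have h1 : k * (‖fn w‖ * (L⁻¹ * ‖fn w‖ + ‖grad w‖)) ≤
      (1 / 2 + 1 / (k * L)) * energyNorm k w ^ 2 := by
    have e1 : k * (‖fn w‖ * (L⁻¹ * ‖fn w‖ + ‖grad w‖)) =
        1 / (k * L) * (k ^ 2 * ‖fn w‖ ^ 2) + k * ‖fn w‖ * ‖grad w‖ := by
      field_simp
    have e2 : k * ‖fn w‖ * ‖grad w‖ ≤ 1 / 2 * energyNorm k w ^ 2 := by
      rw [energyNorm_sq]
      nlinarith [sq_nonneg (k * ‖fn w‖ - ‖grad w‖)]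
    have e3 : 1 / (k * L) * (k ^ 2 * ‖fn w‖ ^ 2) ≤ 1 / (k * L) * energyNorm k w ^ 2 := by
      rw [energyNorm_sq]
      exact mul_le_mul_of_nonneg_left (le_add_of_nonneg_left (sq_nonneg _)) (by positivity)
    rw [e1, add_mul]
    linarith
  calc C * ‖fn w‖ * (L⁻¹ * ‖fn w‖ + ‖grad w‖)
      = C / k * (k * (‖fn w‖ * (L⁻¹ * ‖fn w‖ + ‖grad w‖))) := by
        field_simp
    _ ≤ C / k * ((1 / 2 + 1 / (k * L)) * energyNorm k w ^ 2) :=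
        mul_le_mul_of_nonneg_left h1 (by positivity)
    _ = _ := by ring

theorem IsTraceConstant.mono {L C C' : ℝ} (h : IsTraceConstant D L C) (hL : 0 < L) (hC : C ≤ C') :
    IsTraceConstant D L C' := fun w hw => by
  refine (h w hw).trans ?_
  rw [mul_assoc, mul_assoc]
  exact mul_le_mul_of_nonneg_right hC (by positivity)

/-! ### The Hilbert space of triples and the Lax–Milgram lemma -/

/-- Triples with the Hilbert space structure. -/
abbrev TripleHilbert (D : Set (Space d)) := WithLp 2 (L2 D × WithLp 2 (L2Vec D × L2Bdry D))

/-- The topological identification of the Hilbert space of triples with `Triple D`. -/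
def tripleEquiv (D : Set (Space d)) : TripleHilbert D ≃L[ℂ] Triple D :=
  (WithLp.prodContinuousLinearEquiv 2 ℂ _ _).trans
    ((ContinuousLinearEquiv.refl ℂ _).prodCongr (WithLp.prodContinuousLinearEquiv 2 ℂ _ _))

theorem inner_tripleEquiv (x y : TripleHilbert D) : inner ℂ x y =
    inner ℂ (fn (tripleEquiv D x)) (fn (tripleEquiv D y)) +
      (inner ℂ (grad (tripleEquiv D x)) (grad (tripleEquiv D y)) +
        inner ℂ (trace (tripleEquiv D x)) (trace (tripleEquiv D y))) := by
  rw [WithLp.prod_inner_apply, WithLp.prod_inner_apply]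
  rfl

theorem norm_sq_tripleEquiv (x : TripleHilbert D) : ‖x‖ ^ 2 = ‖fn (tripleEquiv D x)‖ ^ 2 +
    (‖grad (tripleEquiv D x)‖ ^ 2 + ‖trace (tripleEquiv D x)‖ ^ 2) := by
  rw [WithLp.prod_norm_sq_eq_of_L2, WithLp.prod_norm_sq_eq_of_L2]
  rfl

/-- The Lax–Milgram lemma on a closed subspace of a complex Hilbert space. -/
theorem exists_forall_inner_eq_of_coercive {E : Type*} [NormedAddCommGroup E]
    [InnerProductSpace ℂ E] [CompleteSpace E] (V : Submodule ℂ E) (hV : IsClosed (V : Set E))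
    (T : E →L[ℂ] E) {c : ℝ} (hc : 0 < c) (h : ∀ u ∈ V, c * ‖u‖ ^ 2 ≤ ‖inner ℂ u (T u)‖) (g : E) :
    ∃ u ∈ V, ∀ v ∈ V, inner ℂ v (T u) = inner ℂ v g := by
  have : CompleteSpace V := hV.completeSpace_coe
  have key : ∀ (x : E) (v : V), inner ℂ v (V.orthogonalProjectionOnto x) = inner ℂ (v : E) x :=
    fun x v => by
      rw [← inner_conj_symm, Submodule.inner_orthogonalProjectionOnto_eq_of_mem_right,
        inner_conj_symm]
  have hu : IsUnit (V.orthogonalProjectionOnto ∘L T ∘L V.subtypeL) := by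
    refine ContinuousLinearMap.isUnit_of_forall_le_norm_inner_map _ (c := ⟨c, hc.le⟩) hc ?_
    intro x
    rw [norm_inner_symm, mul_comm]
    change c * ‖(x : E)‖ ^ 2 ≤ ‖inner ℂ x (V.orthogonalProjectionOnto (T x))‖
    rw [key]
    exact h x x.2
  obtain ⟨u, hu⟩ := (ContinuousLinearMap.isUnit_iff_bijective.1 hu).2 (V.orthogonalProjectionOnto g)
  refine ⟨u, u.2, fun v hv => ?_⟩
  have h1 := key (T u) ⟨v, hv⟩
  have h2 := key g ⟨v, hv⟩
  rw [← h1, ← h2]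
  exact congrArg _ hu

/-- The form is represented by a bounded operator on the Hilbert space of triples. -/
theorem IsFormRepr.exists_operator
    (R : IsFormRepr (D := D) ΓD A n Amin Amax nmin nmax SA SN SB) (k ε : ℝ) (η : ℂ) :
    ∃ (e : TripleHilbert D ≃L[ℂ] Triple D) (T : TripleHilbert D →L[ℂ] TripleHilbert D),
      (∀ x, ‖x‖ ^ 2 = ‖fn (e x)‖ ^ 2 + (‖grad (e x)‖ ^ 2 + ‖trace (e x)‖ ^ 2)) ∧
      (∀ x y, inner ℂ y (T x) = form ΓD A n k ε η (e x) (e y)) ∧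
      ∀ (f : L2 D) y, inner ℂ y (e.symm (f, 0, 0)) = inner ℂ (fn (e y)) f := by
  refine ⟨tripleEquiv D, (tripleEquiv D).symm.toContinuousLinearMap ∘L
    ((-((k : ℂ) ^ 2 + Complex.I * ε) • SN).prodMap (SA.prodMap (-(Complex.I * η) • SB))) ∘L
      (tripleEquiv D).toContinuousLinearMap, norm_sq_tripleEquiv, fun x y => ?_, fun f y => ?_⟩
  · have h1 : inner ℂ y ((tripleEquiv D).symm (-((k : ℂ) ^ 2 + Complex.I * ε) •
        SN (fn (tripleEquiv D x)), SA (grad (tripleEquiv D x)),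
        -(Complex.I * η) • SB (trace (tripleEquiv D x)))) =
        form ΓD A n k ε η (tripleEquiv D x) (tripleEquiv D y) := by
      rw [inner_tripleEquiv, ContinuousLinearEquiv.apply_symm_apply, R.form_eq]
      simp only [fn, grad, trace, inner_smul_right]
      ring
    exact h1
  · rw [inner_tripleEquiv, ContinuousLinearEquiv.apply_symm_apply]
    simp only [fn, grad, trace, inner_zero_right, add_zero]

/-- With absorption the form is coercive. -/
theorem IsFormRepr.exists_coercive_of_absorption
    (R : IsFormRepr (D := D) ΓD A n Amin Amax nmin nmax SA SN SB)
    (hα : 0 < min Amin nmin) (hk : 0 < k) {L C s : ℝ} (hL : 0 < L) (hC : IsTraceConstant D L C)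
    (hs : |s| = 1) (hε : 0 < s * ε) (him : 0 ≤ η.im) (hre : 0 ≤ s * η.re) :
    ∃ c : ℝ, 0 < c ∧ ∀ u ∈ H1 D, c * (‖fn u‖ ^ 2 + (‖grad u‖ ^ 2 + ‖trace u‖ ^ 2)) ≤
      ‖form ΓD A n k ε η u u‖ := by
  -- The smallest weight with $ts\varepsilon\ge2k^2$. It blows up as the absorption vanishes, so
  -- this coercivity alone does not reach $\varepsilon=0$.
  set t : ℝ := 2 * k ^ 2 / (s * ε)
  have ht : 0 < t := by positivity
  set τ : ℝ := max C 0 / k * (1 / 2 + 1 / (k * L)) with hτ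
  have hτ0 : 0 ≤ τ := by positivity
  refine ⟨min Amin nmin / ((1 + t) * ((k ^ 2)⁻¹ + 1 + τ)), by positivity, fun u hu => ?_⟩
  have h1 := R.energy_le_re_sub_im (t := t) (k := k) (ε := ε) (η := η) (s := s)
    (by rw [div_mul_cancel₀ _ hε.ne']) him (mul_nonneg ht.le hre)
    (hα.le.trans (min_le_right _ _)) u
  set a := form ΓD A n k ε η u u
  have h2 : a.re - t * s * a.im ≤ (1 + t) * ‖a‖ := by
    have e1 := (le_abs_self _).trans (Complex.abs_re_le_norm a)
    have e2 : -(t * s * a.im) ≤ t * ‖a‖ := by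
      refine (neg_le_abs _).trans ?_
      rw [abs_mul, abs_mul, hs, mul_one, abs_of_pos ht]
      exact mul_le_mul_of_nonneg_left (Complex.abs_im_le_norm a) ht.le
    linarith
  have h3 : ‖fn u‖ ^ 2 + (‖grad u‖ ^ 2 + ‖trace u‖ ^ 2) ≤
      ((k ^ 2)⁻¹ + 1 + τ) * energyNorm k u ^ 2 := by
    have e1 := (hC.mono hL (le_max_left C 0)).trace_sq_le hL (le_max_right _ _) hk hu
    have e2 : ‖fn u‖ ^ 2 ≤ (k ^ 2)⁻¹ * energyNorm k u ^ 2 := by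
      rw [← div_eq_inv_mul, le_div_iff₀ (by positivity), mul_comm, energyNorm_sq]
      exact le_add_of_nonneg_left (sq_nonneg _)
    have e3 : ‖grad u‖ ^ 2 ≤ energyNorm k u ^ 2 :=
      pow_le_pow_left₀ (norm_nonneg _) (norm_grad_le_energyNorm u) 2
    rw [← hτ] at e1
    linarith
  rw [div_mul_eq_mul_div, div_le_iff₀ (by positivity)]
  have h4 := mul_le_mul_of_nonneg_left h3 hα.le
  have h5 := mul_le_mul_of_nonneg_left (h1.trans h2)
    (show 0 ≤ (k ^ 2)⁻¹ + 1 + τ by positivity)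
  linarith

/-- Solvability of the local problem with absorption. -/
theorem IsFormRepr.exists_solution_of_absorption
    (R : IsFormRepr (D := D) ΓD A n Amin Amax nmin nmax SA SN SB) (hΓ : MeasurableSet ΓD)
    (hα : 0 < min Amin nmin) (hk : 0 < k) {L C s : ℝ} (hL : 0 < L) (hC : IsTraceConstant D L C)
    (hs : |s| = 1) (hε : 0 < s * ε) (him : 0 ≤ η.im) (hre : 0 ≤ s * η.re) (f : L2 D) :
    ∃ u, IsLocalSolution ΓD A n k ε η f u := by
  obtain ⟨c, hc, hcoer⟩ := R.exists_coercive_of_absorption hα hk hL hC hs hε him hre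
  obtain ⟨e, T, hnorm, hT, hf⟩ := R.exists_operator k ε η
  obtain ⟨x, hx, hxv⟩ := exists_forall_inner_eq_of_coercive
    ((H10 D ΓD).comap e.toContinuousLinearMap.toLinearMap)
    ((isClosed_H10 hΓ).preimage e.continuous) T hc
    (fun u hu => by
      rw [hT, hnorm]
      exact hcoer _ (Submodule.mem_comap.1 hu).1) (e.symm (f, 0, 0))
  refine ⟨e x, Submodule.mem_comap.1 hx, fun v hv => ?_⟩
  have h1 := hxv (e.symm v) (by
    rw [Submodule.mem_comap]
    exact (e.apply_symm_apply v).symm ▸ hv)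
  rwa [hT, hf, e.apply_symm_apply, ← ip_eq_inner] at h1

/-- Solvability of the local problem by continuation in the absorption parameter: an a priori bound
at `ε` yields a uniform bound for nearby absorption, hence a contraction. -/
theorem IsFormRepr.exists_solution
    (R : IsFormRepr (D := D) ΓD A n Amin Amax nmin nmax SA SN SB) (hΓ : MeasurableSet ΓD)
    (hα : 0 < min Amin nmin) (hn : 0 < nmax) (hk : 0 < k) {L C H Csol : ℝ} (hL : 0 < L)
    (hC : IsTraceConstant D L C) (him : 0 ≤ η.im) (hre : 0 ≤ sgn ε * η.re)
    (hsol : IsSolutionBound D ΓD A n k ε η H Csol) (f : L2 D) :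
    ∃ u, IsLocalSolution ΓD A n k ε η f u := by
  -- The sign of `Csol * H` is not yet known, and a positive bound is needed for the division below.
  set B : ℝ := max (Csol * H) 1
  have hB : 0 < B := lt_of_lt_of_le one_pos (le_max_right _ _)
  have hbound : ∀ (g : L2 D) (u : Triple D), IsLocalSolution ΓD A n k ε η g u →
      energyNorm k u ≤ B * ‖g‖ := fun g u h =>
    (hsol g u h).trans (mul_le_mul_of_nonneg_right (le_max_left _ _) (norm_nonneg _))
  -- Chosen so that the shift of the absorption, measured through the a priori bound, has relative
  -- size $1/4$ (`hδB`). The sign of the shift increases $|\varepsilon|$, so the problem at `ε'` is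
  -- coercive even if $\varepsilon=0$; $\eta$ stays fixed.
  set δ : ℝ := k / (4 * B * nmax) with hδdef
  have hδ : 0 < δ := by positivity
  set ε' : ℝ := ε + sgn ε * δ
  set c : ℂ := Complex.I * (ε' - ε : ℝ)
  have hc : ‖c‖ = δ := by
    have : ε' - ε = sgn ε * δ := by simp [ε']
    rw [norm_mul, Complex.norm_I, one_mul, this, Complex.norm_real, Real.norm_eq_abs, abs_mul,
      abs_of_pos hδ]
    unfold sgn
    split_ifs <;> simp
  have hs : |sgn ε| = 1 := by
    unfold sgn
    split_ifs <;> simp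
  have hε' : 0 < sgn ε * ε' := by
    rw [mul_add, ← mul_assoc, sgn_mul_self, sgn_mul_eq_abs, one_mul]
    positivity
  have hSN : ∀ w : Triple D, ‖c • SN (fn w)‖ ≤ δ * (nmax * (energyNorm k w / k)) := by
    intro w
    rw [norm_smul, hc]
    refine mul_le_mul_of_nonneg_left ((R.norm_SN_le _).trans ?_) hδ.le
    refine mul_le_mul_of_nonneg_left ?_ hn.le
    rw [le_div_iff₀ hk, mul_comm]
    exact mul_norm_fn_le_energyNorm k w
  have hδB : ∀ x : ℝ, B * (δ * (nmax * (x / k))) = x / 4 := by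
    intro x
    rw [hδdef]
    field_simp
  have hshift : ∀ {g : L2 D} {u : Triple D}, IsLocalSolution ΓD A n k ε' η g u →
      IsLocalSolution ΓD A n k ε η (g + c • SN (fn u)) u := by
    intro g u hu
    refine ⟨hu.1, fun v hv => ?_⟩
    rw [R.form_absorption ε', hu.2 v hv, ip_eq_inner, ip_eq_inner, inner_add_right,
      inner_smul_right]
  -- The term of relative size $1/4$ is absorbed on the left, whence $4/3$: a bound at `ε'` that
  -- does not involve the coercivity constant.
  have hunif : ∀ {g : L2 D} {u : Triple D}, IsLocalSolution ΓD A n k ε' η g u →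
      energyNorm k u ≤ 4 / 3 * B * ‖g‖ := by
    intro g u hu
    have h1 := hbound _ _ (hshift hu)
    have h2 : B * ‖g + c • SN (fn u)‖ ≤ B * (‖g‖ + δ * (nmax * (energyNorm k u / k))) :=
      mul_le_mul_of_nonneg_left ((norm_add_le _ _).trans (add_le_add le_rfl (hSN u))) hB.le
    rw [mul_add, hδB] at h2
    linarith
  choose S hS using R.exists_solution_of_absorption hΓ hα hk hL hC hs hε' him hre
  have hdiff : ∀ g g', IsLocalSolution ΓD A n k ε' η (g - g') (S g - S g') := by
    intro g g'
    refine ⟨(H10 D ΓD).sub_mem (hS g).1 (hS g').1, fun v hv => ?_⟩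
    rw [R.form_sub_left, (hS g).2 v hv, (hS g').2 v hv]
    simp only [ip_eq_inner, inner_sub_right]
  -- A fixed point $g=f-c\,n\,S(g)$ is data at `ε'` whose solution solves the problem at `ε` with
  -- data $f$. The Lipschitz constant is $\frac14\cdot\frac43=\frac13\le\frac12$.
  have hcontr : ContractingWith (1 / 2) fun g => f - c • SN (fn (S g)) := by
    refine ⟨by rw [← NNReal.coe_lt_coe]; norm_num, LipschitzWith.of_dist_le_mul fun g g' => ?_⟩
    have h1 : f - c • SN (fn (S g)) - (f - c • SN (fn (S g'))) =
        -(c • SN (fn (S g - S g'))) := by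
      simp only [fn, Prod.fst_sub, map_sub, smul_sub]
      abel
    rw [dist_eq_norm, dist_eq_norm, h1, norm_neg]
    have h2 := hunif (hdiff g g')
    have h3 := hδB (energyNorm k (S g - S g'))
    have h4 : B * ‖c • SN (fn (S g - S g'))‖ ≤ B * (1 / 3 * ‖g - g'‖) := by
      refine (mul_le_mul_of_nonneg_left (hSN _) hB.le).trans ?_
      rw [h3]
      linarith
    have h5 := le_of_mul_le_mul_left h4 hB
    have h6 := norm_nonneg (g - g')
    push_cast
    linarith
  have hfix : f - c • SN (fn (S hcontr.fixedPoint)) = hcontr.fixedPoint :=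
    hcontr.fixedPoint_isFixedPt
  refine ⟨S hcontr.fixedPoint, ?_⟩
  have h := hshift (hS hcontr.fixedPoint)
  rwa [← eq_add_of_sub_eq hfix] at h

end

/-! ### Continuity of the form and the duality argument. -/

section

variable {d : ℕ} {D ΓD : Set (Space d)} {A : Space d → Matrix (Fin d) (Fin d) ℝ}
  {n : Space d → ℝ} {Amin Amax nmin nmax k ε : ℝ} {η : ℂ} {SA : L2Vec D →L[ℂ] L2Vec D}
  {SN : L2 D →L[ℂ] L2 D} {SB : L2Bdry D →L[ℂ] L2Bdry D}

/-! ### Uniqueness of the weak gradient -/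

/-- The fundamental lemma of the calculus of variations, componentwise. It makes the gradient entry
of a triple depend only on its function entry. -/
theorem IsWeakGrad.eq_zero (hD : IsOpen D) {G : L2Vec D} (h : IsWeakGrad 0 G) : G = 0 := by
  have hi : ∀ i : Fin d, ∀ᵐ x ∂(volume.restrict D), G x i = 0 := by
    intro i
    refine (ae_restrict_iff' hD.measurableSet).2 ?_
    refine hD.ae_eq_zero_of_integral_contDiff_smul_eq_zero (f := fun x => G x i) ?_ ?_
    · exact (locallyIntegrableOn_of_locallyIntegrable_restrict
        ((memLp_component G i).locallyIntegrable (by norm_num)))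
    · intro φ h1 h2 h3
      have h4 := h φ h1 h2 h3 i
      have h5 : ∫ x in D, (0 : L2 D) x * (fderiv ℝ φ x (EuclideanSpace.single i 1) : ℝ) = 0 := by
        refine integral_eq_zero_of_ae ?_
        filter_upwards [Lp.coeFn_zero ℂ 2 (volume.restrict D)] with x hx
        simp only [hx, Pi.zero_apply, zero_mul]
      rw [h5, zero_eq_neg] at h4
      rw [← setIntegral_eq_integral_of_forall_compl_eq_zero (s := D), ← h4]
      · refine integral_congr_ae (Eventually.of_forall fun x => ?_)
        simp only [Complex.real_smul, mul_comm]
      · intro x hx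
        rw [image_eq_zero_of_notMem_tsupport fun hx' => hx (h3 hx'), zero_smul]
  refine Lp.ext ?_
  filter_upwards [ae_all_iff.2 hi, Lp.coeFn_zero (EuclideanSpace ℂ (Fin d)) 2 (volume.restrict D)]
    with x h1 h2
  rw [h2]
  ext i
  exact h1 i

theorem grad_eq_zero_of_fn_eq_zero (hD : IsOpen D) {w : Triple D} (hw : w ∈ H1 D)
    (h0 : fn w = 0) : grad w = 0 := by
  have h := hw.1
  rw [h0] at h
  exact h.eq_zero hD

/-! ### Continuity of the form -/

theorem norm_le_sqrt_two_mul_sq (hε : |ε| ≤ k ^ 2) :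
    ‖(k : ℂ) ^ 2 + Complex.I * ε‖ ≤ Real.sqrt 2 * k ^ 2 := by
  have h1 : (k : ℂ) ^ 2 + Complex.I * ε = ((k ^ 2 : ℝ) : ℂ) + ((ε : ℝ) : ℂ) * Complex.I := by
    push_cast
    ring
  rw [h1, Complex.norm_add_mul_I]
  refine Real.sqrt_le_iff.2 ⟨by positivity, ?_⟩
  rw [mul_pow, Real.sq_sqrt (by norm_num)]
  have h2 : ε ^ 2 ≤ (k ^ 2) ^ 2 := sq_le_sq' (abs_le.1 hε).1 (abs_le.1 hε).2
  linarith

theorem IsFormRepr.norm_form_le (R : IsFormRepr (D := D) ΓD A n Amin Amax nmin nmax SA SN SB)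
    (hn : 0 ≤ nmax) (hk : 0 < k) (hε : |ε| ≤ k ^ 2) {L C : ℝ} (hL : 0 < L) (hC0 : 0 ≤ C)
    (hC : IsTraceConstant D L C) {u v : Triple D} (hu : u ∈ H1 D) (hv : v ∈ H1 D) :
    ‖form ΓD A n k ε η u v‖ ≤
      contConst Amax nmax C k η L * (energyNorm k u * energyNorm k v) := by
  set m := max Amax (Real.sqrt 2 * nmax) with hm
  set τ : ℝ := C / k * (1 / 2 + 1 / (k * L)) with hτ
  have hτ0 : 0 ≤ τ := by positivity
  have h1 : ‖inner ℂ (grad v) (SA (grad u))‖ ≤ m * (‖grad u‖ * ‖grad v‖) := by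
    refine (norm_inner_le_norm _ _).trans ?_
    calc ‖grad v‖ * ‖SA (grad u)‖ ≤ ‖grad v‖ * (m * ‖grad u‖) :=
          mul_le_mul_of_nonneg_left ((R.norm_SA_le _).trans
            (mul_le_mul_of_nonneg_right (le_max_left _ _) (norm_nonneg _))) (norm_nonneg _)
      _ = _ := by ring
  have h2 : ‖((k : ℂ) ^ 2 + Complex.I * ε) * inner ℂ (fn v) (SN (fn u))‖ ≤
      m * (k ^ 2 * (‖fn u‖ * ‖fn v‖)) := by
    rw [norm_mul]
    calc _ ≤ (Real.sqrt 2 * k ^ 2) * (‖fn v‖ * (nmax * ‖fn u‖)) :=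
          mul_le_mul (norm_le_sqrt_two_mul_sq hε) ((norm_inner_le_norm _ _).trans
            (mul_le_mul_of_nonneg_left (R.norm_SN_le _) (norm_nonneg _))) (norm_nonneg _)
            (by positivity)
      _ = (Real.sqrt 2 * nmax) * (k ^ 2 * (‖fn u‖ * ‖fn v‖)) := by ring
      _ ≤ _ := mul_le_mul_of_nonneg_right (le_max_right _ _) (by positivity)
  have h3 : ‖trace u‖ * ‖trace v‖ ≤ τ * (energyNorm k u * energyNorm k v) := by
    refine le_of_sq_le_sq ?_ (mul_nonneg hτ0 (mul_nonneg (energyNorm_nonneg k u)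
      (energyNorm_nonneg k v)))
    calc (‖trace u‖ * ‖trace v‖) ^ 2 = ‖trace u‖ ^ 2 * ‖trace v‖ ^ 2 := mul_pow _ _ _
      _ ≤ (τ * energyNorm k u ^ 2) * (τ * energyNorm k v ^ 2) :=
          mul_le_mul (hC.trace_sq_le hL hC0 hk hu) (hC.trace_sq_le hL hC0 hk hv) (sq_nonneg _)
            (by positivity)
      _ = _ := by ring
  have h4 : ‖Complex.I * η * inner ℂ (trace v) (SB (trace u))‖ ≤
      ‖η‖ * Real.sqrt nmax * τ * (energyNorm k u * energyNorm k v) := by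
    rw [norm_mul, norm_mul, Complex.norm_I, one_mul]
    calc ‖η‖ * ‖inner ℂ (trace v) (SB (trace u))‖
        ≤ ‖η‖ * (‖trace v‖ * (Real.sqrt nmax * ‖trace u‖)) :=
          mul_le_mul_of_nonneg_left ((norm_inner_le_norm _ _).trans
            (mul_le_mul_of_nonneg_left (R.norm_SB_le _) (norm_nonneg _))) (norm_nonneg _)
      _ = ‖η‖ * Real.sqrt nmax * (‖trace u‖ * ‖trace v‖) := by ring
      _ ≤ ‖η‖ * Real.sqrt nmax * (τ * (energyNorm k u * energyNorm k v)) :=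
          mul_le_mul_of_nonneg_left h3 (by positivity)
      _ = _ := by ring
  have h5 : m * (‖grad u‖ * ‖grad v‖ + k ^ 2 * (‖fn u‖ * ‖fn v‖)) ≤
      m * (energyNorm k u * energyNorm k v) :=
    mul_le_mul_of_nonneg_left (norm_mul_norm_add_le_energyNorm k u v)
      ((by positivity : 0 ≤ Real.sqrt 2 * nmax).trans (le_max_right _ _))
  have h6 : contConst Amax nmax C k η L = m + ‖η‖ * Real.sqrt nmax * τ := by
    rw [contConst, ← hm, hτ]
    ring
  rw [R.form_eq, h6, add_mul (a := m)]
  refine (norm_sub_le _ _).trans (add_le_add ((norm_sub_le _ _).trans ?_) h4)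
  linarith

/-! ### Stability on subspaces -/

/-- The diagonal values of the form at maximal absorption control the energy. -/
theorem IsFormRepr.energy_le_norm_form
    (R : IsFormRepr (D := D) ΓD A n Amin Amax nmin nmax SA SN SB) (hα : 0 ≤ nmin)
    (him : 0 ≤ η.im) (hre : 0 ≤ sgn ε * η.re) (u : Triple D) :
    min Amin nmin * energyNorm k u ^ 2 ≤ 9 / 4 * ‖form ΓD A n k (sgn ε * k ^ 2) η u u‖ := by
  have hs := sgn_mul_self ε
  refine (R.energy_le_re_sub_im (ε := sgn ε * k ^ 2) (t := 2) (s := sgn ε) ?_ him (by linarith) hα u).trans ?_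
  · rw [← mul_assoc (sgn ε), hs, one_mul]
  · set a := form ΓD A n k (sgn ε * k ^ 2) η u u
    -- Cauchy–Schwarz gives $|\operatorname{Re}a-2s\operatorname{Im}a|\le\sqrt5\,|a|$ for $s=\pm1$,
    -- and $\sqrt5\le9/4$.
    refine le_of_sq_le_sq ?_ (by positivity)
    have h1 : ‖a‖ ^ 2 = a.re ^ 2 + a.im ^ 2 := by
      rw [← Complex.normSq_eq_norm_sq, Complex.normSq_apply]
      ring
    rw [mul_pow, h1]
    have h2 : (a.re - 2 * sgn ε * a.im) ^ 2 + (2 * a.re + sgn ε * a.im) ^ 2 =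
        5 * (a.re ^ 2 + a.im ^ 2) := by
      linear_combination (5 * a.im ^ 2) * hs
    nlinarith [sq_nonneg (2 * a.re + sgn ε * a.im), sq_nonneg a.re, sq_nonneg a.im]

/-- The doubling $2r$ gives strict room above the infimum, so no minimiser in $V$ is needed. -/
theorem exists_near_of_adjointApprox {V : Submodule ℂ (Triple D)} {f : L2 D} (hf : f ≠ 0)
    {s : Triple D} (hs : IsAdjointSolution ΓD A n k ε η f s) {q r : ℝ} (hq : 0 < q) (hr : 0 < r)
    (hsmall : ENNReal.ofReal q * adjointApprox ΓD A n k ε η V ≤ ENNReal.ofReal r) :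
    ∃ v ∈ V, q * energyNorm k (s - v) ≤ 2 * r * ‖f‖ := by
  have hlt : adjointApprox ΓD A n k ε η V < ENNReal.ofReal (2 * r / q) := by
    by_contra! hcon
    have h1 : ENNReal.ofReal (2 * r) ≤ ENNReal.ofReal r := by
      refine le_trans ?_ hsmall
      refine le_trans (le_of_eq ?_) (mul_le_mul_right hcon _)
      rw [← ENNReal.ofReal_mul hq.le, mul_div_cancel₀ _ hq.ne']
    rw [ENNReal.ofReal_le_ofReal_iff hr.le] at h1
    linarith
  have hle : (⨅ v ∈ V, ENNReal.ofReal (energyNorm k (s - v) / ‖f‖)) ≤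
      adjointApprox ΓD A n k ε η V :=
    le_iSup₂_of_le f hf (le_iSup₂_of_le s hs le_rfl)
  obtain ⟨v, hv⟩ := iInf_lt_iff.1 (hle.trans_lt hlt)
  obtain ⟨hvV, hv⟩ := iInf_lt_iff.1 hv
  refine ⟨v, hvV, ?_⟩
  have h1 := (ENNReal.ofReal_lt_ofReal_iff (by positivity)).1 hv
  rw [div_lt_iff₀ (norm_pos_iff.2 hf), div_mul_eq_mul_div, lt_div_iff₀ hq] at h1
  linarith

/-- The Schatz-type argument: smallness of the adjoint approximability implies stability. -/
theorem IsFormRepr.energyNorm_le_of_adjointApprox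
    (R : IsFormRepr (D := D) ΓD A n Amin Amax nmin nmax SA SN SB) (hD : IsOpen D)
    (hsymm : ∀ᵐ x ∂(volume.restrict D), (A x).IsSymm) (hA : 0 < Amin) (hA' : Amin ≤ Amax)
    (hn : 0 < nmin) (hn' : nmin ≤ nmax) (hk : 0 < k) (hε : |ε| ≤ k ^ 2) (him : 0 ≤ η.im)
    (hre : 0 ≤ sgn ε * η.re) {L C H Csol : ℝ} (hL : 0 < L) (hC : IsTraceConstant D L C)
    (hCH : 0 ≤ Csol * H) (hsol : IsSolutionBound D ΓD A n k ε η H Csol)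
    (hex : ∀ f : L2 D, ∃ u, IsLocalSolution ΓD A n k ε η f u) {V : Submodule ℂ (Triple D)}
    (hV : V ≤ H10 D ΓD)
    (hsmall : ENNReal.ofReal (|ε - sgn ε * k ^ 2| / k) * adjointApprox ΓD A n k ε η V ≤
      ENNReal.ofReal (min Amin nmin / (8 * contConst Amax nmax C k η L * nmax)))
    {u : Triple D} (hu : u ∈ V) {M : ℝ} (hM0 : 0 ≤ M)
    (hM : ∀ v ∈ V, ‖form ΓD A n k ε η u v‖ ≤ M * energyNorm k v) :
    energyNorm k u ≤
      (9 + 8 * Csol * H * nmax * (|ε - sgn ε * k ^ 2| / k)) / min Amin nmin * M := by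
  set α := min Amin nmin with hα
  have hα0 : 0 < α := lt_min hA hn
  have hnmax : 0 < nmax := hn.trans_le hn'
  set ε₀ := sgn ε * k ^ 2 with hε₀
  set q := |ε - ε₀| / k with hqdef
  have hq0 : 0 ≤ q := by positivity
  set Q := Csol * H * nmax * q with hQ
  have hQ0 : 0 ≤ Q := by positivity
  have hQ' : 8 * Csol * H * nmax * q = 8 * Q := by
    rw [hQ]
    ring
  rw [hQ']
  have hE0 := energyNorm_nonneg k u
  rcases hE0.eq_or_lt with hE | hE
  · rw [← hE]
    positivity
  have hu1 : u ∈ H1 D := (hV hu).1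
  have hfn : fn u ≠ 0 := fun h0 => by
    have h1 := energyNorm_sq k u
    rw [h0, grad_eq_zero_of_fn_eq_zero hD hu1 h0] at h1
    simp only [norm_zero] at h1
    nlinarith
  have hC0 : 0 ≤ C := hC.nonneg_of_ne_zero hL hu1 hfn
  set Cc := contConst Amax nmax C k η L with hCc
  have hαC : α ≤ Cc := by
    refine (min_le_left _ _).trans (hA'.trans ?_)
    rw [hCc, contConst]
    refine (le_max_left _ _).trans (le_add_of_nonneg_right (by positivity))
  have hCc0 : 0 < Cc := hα0.trans_le hαC
  set E := energyNorm k u with hEdef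
  have hcoer : α * E ^ 2 ≤ 9 / 4 * ‖form ΓD A n k ε₀ η u u‖ :=
    R.energy_le_norm_form (k := k) hn.le him hre u
  -- Here $\frac7{36}=\frac49-\frac14$: coercivity minus the approximation error. Then
  -- $\frac{36}7(\frac54+Q)\le9+8Q$.
  suffices h : 7 / 36 * (α * E) ≤ (5 / 4 + Q) * M by
    rw [div_mul_eq_mul_div, le_div_iff₀ hα0]
    nlinarith [mul_nonneg hQ0 hM0]
  -- If $q=0$ the form itself is at maximal absorption and testing with $u$ suffices. Otherwise the
  -- data $f$ below is nonzero, as the approximability requires.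
  refine le_of_mul_le_mul_right ?_ hE
  rcases hq0.eq_or_lt with hq | hq
  · have h1 : ε = ε₀ := by
      rw [hqdef, eq_comm, div_eq_zero_iff, or_iff_left hk.ne', abs_eq_zero] at hq
      linarith
    rw [← h1] at hcoer
    have h2 := hM u hu
    have h3 : 0 ≤ Q * M * E := by positivity
    have h4 : 0 ≤ M * E := by positivity
    nlinarith
  set c : ℂ := Complex.I * (ε₀ - ε : ℝ) with hc
  have hcn : ‖c‖ = q * k := by
    rw [hc, norm_mul, Complex.norm_I, one_mul, Complex.norm_real, Real.norm_eq_abs, abs_sub_comm,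
      hqdef, div_mul_cancel₀ _ hk.ne']
  set f : L2 D := c • SN (fn u) with hfdef
  have hf0 : f ≠ 0 := by
    refine smul_ne_zero (norm_pos_iff.1 (by rw [hcn]; positivity)) fun h0 => ?_
    have h1 := R.le_SN (fn u)
    rw [h0, inner_zero_right, Complex.zero_re] at h1
    have h2 : 0 < nmin * ‖fn u‖ ^ 2 := mul_pos hn (pow_pos (norm_pos_iff.2 hfn) 2)
    linarith
  have hfn_le : ‖f‖ ≤ q * (nmax * E) := by
    rw [hfdef, norm_smul, hcn]
    calc q * k * ‖SN (fn u)‖ ≤ q * k * (nmax * ‖fn u‖) :=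
          mul_le_mul_of_nonneg_left (R.norm_SN_le _) (by positivity)
      _ = q * (nmax * (k * ‖fn u‖)) := by ring
      _ ≤ q * (nmax * E) := mul_le_mul_of_nonneg_left
          (mul_le_mul_of_nonneg_left (mul_norm_fn_le_energyNorm k u) hnmax.le) hq0
  -- The adjoint solution $s$ is the conjugate of the direct solution with conjugated data, so it
  -- inherits the bound with $C_{\rm sol}$.
  obtain ⟨w, hw⟩ := hex (conjLp f)
  have hs := hw.conj hsymm
  rw [conjLp_conjLp] at hs
  set s := conjTriple w
  have hs_le : energyNorm k s ≤ Csol * H * ‖f‖ := by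
    have h1 := hsol _ _ (hs.conj hsymm)
    rwa [energyNorm_conjTriple, norm_conjLp] at h1
  obtain ⟨v, hv, hsv⟩ := exists_near_of_adjointApprox hf0 hs hq
    (r := α / (8 * Cc * nmax)) (by positivity) hsmall
  -- The factor $q$ in the smallness condition cancels the factor $q$ in $\|f\|\le q\,n_{\max}E$.
  have hsv' : energyNorm k (s - v) ≤ α / (4 * Cc) * E := by
    refine le_of_mul_le_mul_left (hsv.trans ?_) hq
    refine (mul_le_mul_of_nonneg_left hfn_le (by positivity)).trans (le_of_eq ?_)
    field_simp
    norm_num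
  have hv1 : s - v ∈ H1 D := (H1 D).sub_mem hs.1.1 (hV hv).1
  have hform : form ΓD A n k ε η u (u + v) =
      form ΓD A n k ε₀ η u u - form ΓD A n k ε η u (s - v) := by
    -- The adjoint equation yields $\bar c\,(u,nu)$; here $\bar c=-c$ as $c$ is imaginary, and
    -- $(u,nu)$ is real. This is what cancels the zeroth-order change from $\varepsilon$ to
    -- $\varepsilon_0$.
    have h1 : form ΓD A n k ε η u s = -(c * inner ℂ (fn u) (SN (fn u))) := by
      have e1 : conj (inner ℂ (fn u) (SN (fn u))) = inner ℂ (fn u) (SN (fn u)) :=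
        Complex.conj_eq_iff_im.2 (R.im_SN _)
      rw [hs.2 u (hV hu), ip_eq_inner, hfdef, inner_smul_left, ← inner_conj_symm, e1, hc]
      simp
    rw [R.form_add_right, R.form_sub_right, h1, R.form_absorption ε₀ u u, ← hc]
    ring
  have hcross : ‖form ΓD A n k ε η u (s - v)‖ ≤ α / 4 * E ^ 2 := by
    refine (R.norm_form_le hnmax.le hk hε hL hC0 hC hu1 hv1).trans ?_
    calc Cc * (E * energyNorm k (s - v)) ≤ Cc * (E * (α / (4 * Cc) * E)) :=
          mul_le_mul_of_nonneg_left (mul_le_mul_of_nonneg_left hsv' hE0) hCc0.le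
      _ = _ := by field_simp
  have hquarter : α / (4 * Cc) * E ≤ 1 / 4 * E := by
    refine mul_le_mul_of_nonneg_right ?_ hE0
    rw [div_le_div_iff₀ (by positivity) (by norm_num)]
    linarith
  -- From $u+v=u+s-(s-v)$ the three terms contribute $1$, $Q$ and at most $\frac14$, the last
  -- because $\alpha\le C_{\rm cont}$.
  have htest : energyNorm k (u + v) ≤ (5 / 4 + Q) * E := by
    have e1 : u + v = u + s + -(s - v) := by abel
    have e2 := energyNorm_add_le k (u + s) (-(s - v))
    have e3 := energyNorm_add_le k u s
    rw [energyNorm_neg, ← e1] at e2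
    have e4 := mul_le_mul_of_nonneg_left hfn_le hCH
    have e5 : Csol * H * (q * (nmax * E)) = Q * E := by
      rw [hQ]
      ring
    rw [e5] at e4
    linarith
  have hfinal := hM (u + v) (V.add_mem hu hv)
  rw [hform] at hfinal
  have h1 := (norm_sub_norm_le _ _).trans hfinal
  have h2 := mul_le_mul_of_nonneg_left htest hM0
  linarith

end

/-! ### Finite dimension, linear algebra and definiteness. -/

section

variable {d : ℕ} {D ΓD : Set (Space d)}

/-! ### Finite dimension of the local finite element space -/

theorem IsMesh.space_eq_elements {K : Geometry.SimplicialComplex ℝ (Space d)}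
    {Ω : Set (Space d)} (hK : IsMesh K Ω) {x : Space d} (hx : x ∈ closure Ω) :
    ∃ s ∈ elements K, x ∈ convexHull ℝ (s : Set (Space d)) := by
  rw [← hK.space_eq, Geometry.SimplicialComplex.mem_space_iff] at hx
  obtain ⟨s, hs, hxs⟩ := hx
  obtain ⟨t, ht, hst⟩ := hK.pure s hs
  exact ⟨t, ht, convexHull_mono (by exact_mod_cast hst) hxs⟩

/-- The triples in `H¹(D)` together with piecewise polynomials representing function and trace. -/
def piecewiseGraph (D : Set (Space d)) (K : Geometry.SimplicialComplex ℝ (Space d)) (p : ℕ) :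
    Submodule ℂ (Triple D × (elements K → MvPolynomial.restrictTotalDegree (Fin d) ℂ p)) where
  carrier := {w | w.1 ∈ H1 D ∧
    (∀ᵐ x ∂(volume.restrict D), ∀ s : elements K, x ∈ convexHull ℝ (s.1 : Set (Space d)) →
      fn w.1 x = MvPolynomial.eval (fun i => (x i : ℂ)) (w.2 s).1) ∧
    ∀ᵐ x ∂((surface d).restrict (frontier D)), ∀ s : elements K,
      x ∈ convexHull ℝ (s.1 : Set (Space d)) →
      trace w.1 x = MvPolynomial.eval (fun i => (x i : ℂ)) (w.2 s).1}
  zero_mem' := by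
    refine ⟨(H1 D).zero_mem, ?_, ?_⟩
    · filter_upwards [Lp.coeFn_zero ℂ 2 (volume.restrict D)] with x hx s _
      exact hx.trans (by simp)
    · filter_upwards [Lp.coeFn_zero ℂ 2 ((surface d).restrict (frontier D))] with x hx s _
      exact hx.trans (by simp)
  add_mem' := by
    rintro a b ⟨ha, h1, h2⟩ ⟨hb, g1, g2⟩
    refine ⟨(H1 D).add_mem ha hb, ?_, ?_⟩
    · filter_upwards [h1, g1, Lp.coeFn_add (fn a.1) (fn b.1)] with x e1 e2 e3 s hs
      exact e3.trans (by simp [e1 s hs, e2 s hs])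
    · filter_upwards [h2, g2, Lp.coeFn_add (trace a.1) (trace b.1)] with x e1 e2 e3 s hs
      exact e3.trans (by simp [e1 s hs, e2 s hs])
  smul_mem' := by
    rintro c a ⟨ha, h1, h2⟩
    refine ⟨(H1 D).smul_mem c ha, ?_, ?_⟩
    · filter_upwards [h1, Lp.coeFn_smul c (fn a.1)] with x e1 e3 s hs
      exact e3.trans (by simp [e1 s hs, MvPolynomial.smul_eval])
    · filter_upwards [h2, Lp.coeFn_smul c (trace a.1)] with x e1 e3 s hs
      exact e3.trans (by simp [e1 s hs, MvPolynomial.smul_eval])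

/-- A triple is determined by its finitely many element polynomials: these fix function and trace,
since the elements cover the closure of $D$, and the function fixes the weak gradient. The choice of
polynomials need not be unique, hence the detour through `piecewiseGraph`, which embeds into
polynomial tuples and projects onto a space containing `localFE`. -/
theorem finiteDimensional_localFE {K : Geometry.SimplicialComplex ℝ (Space d)}
    {Ω : Set (Space d)} (hK : IsMesh K Ω) (hD : IsOpen D) (hDΩ : D ⊆ Ω) (p : ℕ) :
    FiniteDimensional ℂ (localFE D K p ΓD) := by
  have : Finite (elements K) := (hK.finite.subset fun s hs => hs.1).to_subtype
  have hcov : ∀ x ∈ closure D, ∃ s : elements K, x ∈ convexHull ℝ (s.1 : Set (Space d)) := by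
    intro x hx
    obtain ⟨s, hs, hxs⟩ := hK.space_eq_elements (closure_mono hDΩ hx)
    exact ⟨⟨s, hs⟩, hxs⟩
  have hvol : ∀ᵐ x ∂(volume.restrict D), x ∈ closure D :=
    (ae_restrict_mem hD.measurableSet).mono fun _ hx => subset_closure hx
  have hsurf : ∀ᵐ x ∂((surface d).restrict (frontier D)), x ∈ closure D :=
    (ae_restrict_mem isClosed_frontier.measurableSet).mono fun _ hx => frontier_subset_closure hx
  have hinj : Function.Injective
      ((LinearMap.snd ℂ _ _).comp (piecewiseGraph D K p).subtype) := by
    refine (injective_iff_map_eq_zero _).2 ?_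
    rintro ⟨⟨w, q⟩, hw, h1, h2⟩ (h0 : q = 0)
    subst h0
    have e1 : fn w = 0 := by
      refine Lp.ext ?_
      filter_upwards [h1, hvol, Lp.coeFn_zero ℂ 2 (volume.restrict D)] with x e1 e2 e3
      obtain ⟨s, hs⟩ := hcov x e2
      exact (e1 s hs).trans ((by simp : _ = (0 : ℂ)).trans e3.symm)
    have e2 : trace w = 0 := by
      refine Lp.ext ?_
      filter_upwards [h2, hsurf, Lp.coeFn_zero ℂ 2 ((surface d).restrict (frontier D))]
        with x e1 e2 e3
      obtain ⟨s, hs⟩ := hcov x e2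
      exact (e1 s hs).trans ((by simp : _ = (0 : ℂ)).trans e3.symm)
    have e3 : grad w = 0 := grad_eq_zero_of_fn_eq_zero hD hw e1
    have e4 : w = 0 := Prod.ext e1 (Prod.ext e3 e2)
    subst e4
    rfl
  have hfin : FiniteDimensional ℂ (piecewiseGraph D K p) := FiniteDimensional.of_injective _ hinj
  have hle : localFE D K p ΓD ≤ (piecewiseGraph D K p).map (LinearMap.fst ℂ _ _) := by
    rintro w ⟨hw, v, ⟨_, hv, _⟩, h1, h2⟩
    choose q hq hqv using hv
    refine ⟨(w, fun s => ⟨q s.1 s.2, (MvPolynomial.mem_restrictTotalDegree _ _ _).2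
      (hq s.1 s.2)⟩), ⟨hw, ?_, ?_⟩, rfl⟩
    · filter_upwards [h1] with x e1 s hs
      exact e1.trans (hqv s.1 s.2 x hs)
    · filter_upwards [h2] with x e1 s hs
      exact e1.trans (hqv s.1 s.2 x hs)
  exact Submodule.finiteDimensional_of_le hle

theorem localFE_le_H10 {K : Geometry.SimplicialComplex ℝ (Space d)} {p : ℕ} :
    localFE D K p ΓD ≤ H10 D ΓD := by
  rintro w ⟨hw, v, ⟨_, _, hv⟩, _, h2⟩
  refine ⟨hw, ?_⟩
  filter_upwards [h2] with x hx hxΓ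
  rw [hx, hv x hxΓ]

/-! ### Finite-dimensional solvability -/

/-- On a finite-dimensional space a nondegenerate sesquilinear form represents every antilinear
functional. -/
theorem exists_forall_eq_of_injective {V : Type*} [AddCommGroup V] [Module ℂ V]
    [FiniteDimensional ℂ V] (a : V → V → ℂ) (add_left : ∀ u u' v, a (u + u') v = a u v + a u' v)
    (smul_left : ∀ (c : ℂ) u v, a (c • u) v = c * a u v)
    (add_right : ∀ u v v', a u (v + v') = a u v + a u v')
    (smul_right : ∀ (c : ℂ) u v, a u (c • v) = conj c * a u v)
    (hinj : ∀ u, (∀ v, a u v = 0) → u = 0) (F : V →ₗ⋆[ℂ] ℂ) : ∃ u, ∀ v, a u v = F v := by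
  let b := Module.finBasis ℂ V
  let S : V → V →ₗ⋆[ℂ] ℂ := fun u =>
    { toFun := a u
      map_add' := add_right u
      map_smul' := fun c v => smul_right c u v }
  let T : V →ₗ[ℂ] (Fin (Module.finrank ℂ V) → ℂ) :=
    { toFun := fun u i => a u (b i)
      map_add' := fun u u' => funext fun i => add_left u u' (b i)
      map_smul' := fun c u => funext fun i => smul_left c u (b i) }
  -- Antilinear maps, like linear ones, are determined on a basis; so $T u=0$ means $a(u,\cdot)=0$.
  have hT : Function.Injective T := by
    rw [← LinearMap.ker_eq_bot, LinearMap.ker_eq_bot']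
    intro u hu
    have h1 : S u = 0 := b.ext fun i => congrFun hu i
    exact hinj u fun v => LinearMap.congr_fun h1 v
  obtain ⟨u, hu⟩ := (LinearMap.injective_iff_surjective_of_finrank_eq_finrank (f := T)
    (by simp)).1 hT fun i => F (b i)
  have h1 : S u = F := b.ext fun i => congrFun hu i
  exact ⟨u, fun v => LinearMap.congr_fun h1 v⟩

/-! ### Nonnegativity of the solution bound and definiteness of the energy norm -/

theorem exists_L2_ne_zero (hD : IsOpen D) (hne : D.Nonempty) (hb : Bornology.IsBounded D) :
    ∃ f : L2 D, f ≠ 0 := by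
  have hfin : volume D ≠ ⊤ := hb.measure_lt_top.ne
  refine ⟨indicatorConstLp 2 hD.measurableSet
    (by rw [Measure.restrict_apply_self]; exact hfin) 1, norm_pos_iff.1 ?_⟩
  rw [norm_indicatorConstLp (by norm_num) (by norm_num), norm_one, one_mul, measureReal_def,
    Measure.restrict_apply_self]
  exact Real.rpow_pos_of_pos (ENNReal.toReal_pos (hD.measure_pos volume hne).ne' hfin) _

/-- The energy norm does not see the trace entry; the trace inequality makes it vanish with the
function. -/
theorem IsTraceConstant.eq_zero_of_energyNorm_eq_zero {L C k : ℝ} (hC : IsTraceConstant D L C)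
    (hk : 0 < k) {w : Triple D} (hw : w ∈ H1 D) (h : energyNorm k w = 0) : w = 0 := by
  have h1 : fn w = 0 := norm_le_zero_iff.1 (by
    have := mul_norm_fn_le_energyNorm k w
    rw [h] at this
    exact nonpos_of_mul_nonpos_right this hk)
  have h2 : grad w = 0 := norm_le_zero_iff.1 (h ▸ norm_grad_le_energyNorm w)
  have h3 : trace w = 0 := by
    have := hC w hw
    rw [h1, norm_zero, mul_zero, zero_mul] at this
    exact norm_eq_zero.1 (pow_eq_zero_iff two_ne_zero |>.1 (le_antisymm this (sq_nonneg _)))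
  exact Prod.ext h1 (Prod.ext h2 h3)

end

/-! ### Well-posedness of the Galerkin problem. -/

section

variable {d : ℕ} {D ΓD : Set (Space d)} {A : Space d → Matrix (Fin d) (Fin d) ℝ}
  {n : Space d → ℝ} {Amin Amax nmin nmax k ε : ℝ} {η : ℂ}

/-- Well-posedness of the Galerkin method for the local problem on a finite-dimensional subspace
with small adjoint approximability. -/
theorem exists_unique_galerkin_solution (hd : 0 < d) (hD : IsOpen D) (hne : D.Nonempty)
    (hb : Bornology.IsBounded D) (hΓ : MeasurableSet ΓD)
    (hAn : CoeffBounds D ΓD A n Amin Amax nmin nmax) (hk : 0 < k) (hε : |ε| ≤ k ^ 2)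
    (hη : IsImpedanceParameter k ε η) {L C H Csol : ℝ} (hL : 0 < L) (hC : IsTraceConstant D L C)
    (hsol : IsSolutionBound D ΓD A n k ε η H Csol) (V : Submodule ℂ (Triple D))
    [FiniteDimensional ℂ V] (hV : V ≤ H10 D ΓD)
    (hsmall : ENNReal.ofReal (|ε - sgn ε * k ^ 2| / k) * adjointApprox ΓD A n k ε η V ≤
      ENNReal.ofReal (min Amin nmin / (8 * contConst Amax nmax C k η L * nmax)))
    (F : V →ₗ⋆[ℂ] ℂ) :
    ∃ u : V, (∀ v, form ΓD A n k ε η u.1 v.1 = F v) ∧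
      (∀ u', (∀ v, form ΓD A n k ε η u'.1 v.1 = F v) → u' = u) ∧
      energyNorm k u.1 ≤
        (9 + 8 * Csol * H * nmax * (|ε - sgn ε * k ^ 2| / k)) / min Amin nmin *
          ⨆ v : V, ‖F v‖ / energyNorm k v.1 := by
  have hvol : volume.restrict D ≠ 0 := by
    rw [Ne, Measure.restrict_eq_zero]
    exact (hD.measure_pos volume hne).ne'
  have hA := hAn.Amin_le_Amax hvol hd
  have hn := hAn.nmin_le_nmax hvol
  have hnmax := hAn.nmin_pos.trans_le hn
  obtain ⟨him, hre⟩ := hη.nonneg hk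
  obtain ⟨SA, SN, SB, R⟩ := exists_isFormRepr hAn hΓ (hAn.Amin_pos.le.trans hA)
  have hex := R.exists_solution hΓ (lt_min hAn.Amin_pos hAn.nmin_pos) hnmax hk hL hC him hre hsol
  -- Solvability for one nonzero $f$ forces the sign of the bound.
  have hCH : 0 ≤ Csol * H := by
    obtain ⟨f, hf⟩ := exists_L2_ne_zero hD hne hb
    obtain ⟨w, hw⟩ := hex f
    exact nonneg_of_mul_nonneg_left ((energyNorm_nonneg k w).trans (hsol f w hw))
      (norm_pos_iff.2 hf)
  have hstab : ∀ (u : V) (M : ℝ), 0 ≤ M →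
      (∀ v : V, ‖form ΓD A n k ε η u.1 v.1‖ ≤ M * energyNorm k v.1) → energyNorm k u.1 ≤
        (9 + 8 * Csol * H * nmax * (|ε - sgn ε * k ^ 2| / k)) / min Amin nmin * M :=
    fun u M hM0 hM => R.energyNorm_le_of_adjointApprox hD hAn.symm_A hAn.Amin_pos hA hAn.nmin_pos
      hn hk hε him hre hL hC hCH hsol hex hV hsmall u.2 hM0 fun v hv => hM ⟨v, hv⟩
  have hdef : ∀ v : V, energyNorm k v.1 = 0 → v = 0 := fun v h =>
    Subtype.ext (hC.eq_zero_of_energyNorm_eq_zero hk (hV v.2).1 h)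
  have hinj : ∀ u : V, (∀ v : V, form ΓD A n k ε η u.1 v.1 = 0) → u = 0 := by
    intro u hu
    have h1 := hstab u 0 le_rfl fun v => by rw [hu v, norm_zero, zero_mul]
    rw [mul_zero] at h1
    exact hdef u (le_antisymm h1 (energyNorm_nonneg k u.1))
  obtain ⟨u, hu⟩ : ∃ u : V, ∀ v : V, form ΓD A n k ε η u.1 v.1 = F v :=
    exists_forall_eq_of_injective (fun u v : V => form ΓD A n k ε η u.1 v.1)
      (fun u u' v => R.form_add_left u.1 u'.1 v.1) (fun c u v => R.form_smul_left c u.1 v.1)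
      (fun u v v' => R.form_add_right u.1 v.1 v'.1) (fun c u v => R.form_smul_right c u.1 v.1)
      hinj F
  refine ⟨u, hu, fun u' hu' => sub_eq_zero.1 (hinj (u' - u) fun v => ?_), ?_⟩
  · refine (R.form_sub_left u'.1 u.1 v.1).trans ?_
    rw [hu' v, hu v, sub_self]
  -- A real supremum over an unbounded set would be $0$, so finiteness must be shown. It follows
  -- from continuity of the form, as $F=a(u,\cdot)$; the index $v=0$ contributes $0/0=0$.
  have hbdd : BddAbove (Set.range fun v : V => ‖F v‖ / energyNorm k v.1) := by
    refine ⟨contConst Amax nmax (max C 0) k η L * energyNorm k u.1, ?_⟩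
    rintro _ ⟨v, rfl⟩
    have h1 := R.norm_form_le (η := η) hnmax.le hk hε hL (le_max_right C 0)
      (hC.mono hL (le_max_left _ _)) (hV u.2).1 (hV v.2).1
    rw [hu v, ← mul_assoc] at h1
    refine div_le_of_le_mul₀ (energyNorm_nonneg k v.1) ?_ h1
    refine mul_nonneg ?_ (energyNorm_nonneg k u.1)
    rw [contConst]
    have h3 : 0 ≤ max Amax (Real.sqrt 2 * nmax) :=
      (hAn.Amin_pos.le.trans hA).trans (le_max_left _ _)
    positivity
  refine hstab u _ (Real.iSup_nonneg fun v => div_nonneg (norm_nonneg _)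
    (energyNorm_nonneg k v.1)) fun v => ?_
  rw [hu v]
  rcases (energyNorm_nonneg k v.1).eq_or_lt with h0 | h0
  · rw [← h0, mul_zero, hdef v h0.symm, map_zero, norm_zero]
  · exact (div_le_iff₀ h0).1 (le_ciSup hbdd v)

end

end LocalHelmholtz

end

theorem mainTheorem8 {d N : ℕ} (hd : d = 2 ∨ d = 3)
    -- the obstacle, the outer domain, the mesh of the domain and the polynomial degree
    (Ωm Ωout : Set (LocalHelmholtz.Space d)) (hΩ : LocalHelmholtz.IsObstacleInDomain Ωm Ωout)
    (K : Geometry.SimplicialComplex ℝ (LocalHelmholtz.Space d))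
    (hK : LocalHelmholtz.IsMesh K (Ωout \ closure Ωm)) (p : ℕ)
    -- the subdomains, their length scales, and the subdomain that is considered
    (Ωs : Fin N → Set (LocalHelmholtz.Space d)) (Hs : Fin N → ℝ)
    (hΩs : LocalHelmholtz.IsDecomposition K (Ωout \ closure Ωm) (frontier Ωm) Ωs Hs)
    (l : Fin N)
    -- the coefficients and their bounds on the subdomain
    (A : LocalHelmholtz.Space d → Matrix (Fin d) (Fin d) ℝ) (n : LocalHelmholtz.Space d → ℝ)
    (Amin Amax nmin nmax : ℝ)
    (hAn : LocalHelmholtz.CoeffBounds (Ωs l) (frontier Ωm) A n Amin Amax nmin nmax)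
    -- the wavenumber, the absorption and the impedance parameter
    (k ε : ℝ) (hk : 0 < k) (hε : |ε| ≤ k ^ 2) (η : ℂ)
    (hη : LocalHelmholtz.IsImpedanceParameter k ε η)
    -- the constants of the trace inequality and of the local solution operator
    (Ctr Csol : ℝ) (hCtr : LocalHelmholtz.IsTraceConstant (Ωs l) (Hs l) Ctr)
    (hCsol : LocalHelmholtz.IsSolutionBound (Ωs l) (frontier Ωm) A n k ε η (⨆ j, Hs j) Csol)
    -- the smallness condition on the adjoint approximability
    (hsmall : ENNReal.ofReal (|ε - LocalHelmholtz.sgn ε * k ^ 2| / k) *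
        LocalHelmholtz.adjointApprox (frontier Ωm) A n k ε η
          (LocalHelmholtz.localFE (Ωs l) K p (frontier Ωm)) ≤
      ENNReal.ofReal
        (min Amin nmin / (8 * LocalHelmholtz.contConst Amax nmax Ctr k η (Hs l) * nmax)))
    -- the data, a (continuous) antilinear functional
    (F : LocalHelmholtz.localFE (Ωs l) K p (frontier Ωm) →ₗ⋆[ℂ] ℂ) :
    ∃ u : LocalHelmholtz.localFE (Ωs l) K p (frontier Ωm),
      (∀ v, LocalHelmholtz.form (frontier Ωm) A n k ε η u.1 v.1 = F v) ∧
      (∀ u', (∀ v, LocalHelmholtz.form (frontier Ωm) A n k ε η u'.1 v.1 = F v) → u' = u) ∧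
      LocalHelmholtz.energyNorm k u.1 ≤
        (9 + 8 * Csol * (⨆ j, Hs j) * nmax * (|ε - LocalHelmholtz.sgn ε * k ^ 2| / k)) /
            min Amin nmin *
          ⨆ v : LocalHelmholtz.localFE (Ωs l) K p (frontier Ωm),
            ‖F v‖ / LocalHelmholtz.energyNorm k v.1 := by
  have : FiniteDimensional ℂ (LocalHelmholtz.localFE (Ωs l) K p (frontier Ωm)) :=
    LocalHelmholtz.finiteDimensional_localFE hK (hΩs.polytope l).isOpen (hΩs.subset l) p
  exact LocalHelmholtz.exists_unique_galerkin_solution (by omega) (hΩs.polytope l).isOpen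
    (hΩs.nonempty l) (hΩs.polytope l).isBounded isClosed_frontier.measurableSet hAn hk hε hη
    (hΩs.length_pos l) hCtr hCsol _ LocalHelmholtz.localFE_le_H10 hsmall F
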